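/- Let $X_1,X_2,\dots$ be i.i.d. random variables with $\mathbb P(X_i=1)=\mathbb P(X_i=-1)=\frac12$. For a sequence ${\bf a}=(a_1,a_2,\dots)$ of non-negative numbers, the ${\bf a}$-walk is $S(n)=a_1X_1+\dots+a_nX_n$, $S(0)=0$; it is a.s. recurrent if almost surely $S(n)=0$ for infinitely many $n$. Say that a sequence $L_1,L_2,\dots$ of non-negative integers satisfies the growth condition if there are $\varepsilon>0$, $r>0$ and $k_0$ such that $$ L_k\ge (2+\varepsilon)\ln k\,\bigl(L_1+L_2+\dots+L_{k'}\bigr),\qquad L_k\ge 2r\,\bigl(L_{k'+1}+L_{k'+2}+\dots+L_{k-1}\bigr),\qquad L_k\ge k^4 $$ for all integers $k\ge 2$ and $k'\ge 1$ with $k,k'\ge k_0$ and $k-k'\ge \frac{k}{\ln k}-2$. 1. Let $L_k\ge 1$ $(k=1,2,\dots)$ be integers satisfying the growth condition, and let ${\bf a}=(B_1,B_2,B_3,\dots)$, where $B_k$ is a block of exactly $L_k$ consecutive entries equal to $k$. Then the ${\bf a}$-walk is a.s. recurrent. 2. Let $\gamma>1$, $\beta\in(0,1]$ and $a_i=\lfloor(\log_\gamma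 i)^\beta\rfloor$, $i=1,2,\dots$. Then the numbers $L_k=\#\{i\ge 1: a_i=k\}$, $k\ge 1$, satisfy the growth condition, and the ${\bf a}$-walk is a.s. recurrent. 3. Let $\gamma>1$ and $a_i=\lceil\log_\gamma i\rceil$, $i=1,2,\dots$. Then the numbers $L_k=\#\{i\ge 1: a_i=k\}$, $k\ge 1$, satisfy the growth condition, and the ${\bf a}$-walk is a.s. recurrent. -/

import Mathlib

open MeasureTheory ProbabilityTheory Filter

/-- `X 1, X 2, …` are i.i.d. random variables on `(Ω, μ)` with
`P(X = 1) = P(X = -1) = 1/2`.  The value `X 0` plays no role. -/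
structure IsRademacherSeq {Ω : Type*} [MeasurableSpace Ω] (μ : Measure Ω)
    (X : ℕ → Ω → ℝ) : Prop where
  measurable : ∀ i, 1 ≤ i → Measurable (X i)
  indep : iIndepFun (fun i : ℕ => X (i + 1)) μ
  prob_one : ∀ i, 1 ≤ i → μ {ω | X i ω = 1} = 1 / 2
  prob_neg_one : ∀ i, 1 ≤ i → μ {ω | X i ω = -1} = 1 / 2

/-- The `a`-walk `S(n) = a₁ X₁ + ⋯ + aₙ Xₙ`, with `S(0) = 0`. -/
noncomputable def aWalk {Ω : Type*} (a : ℕ → ℝ) (X : ℕ → Ω → ℝ) (n : ℕ) (ω : Ω) : ℝ :=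
  ∑ i ∈ Finset.Icc 1 n, a i * X i ω

/-- The `a`-walk is a.s. recurrent: almost surely `S(n) = 0` for infinitely many `n`. -/
def AWalkRecurrent {Ω : Type*} [MeasurableSpace Ω] (μ : Measure Ω)
    (a : ℕ → ℝ) (X : ℕ → Ω → ℝ) : Prop :=
  ∀ᵐ ω ∂μ, ∃ᶠ n in atTop, aWalk a X n ω = 0

/-- The sequence made of `L 1` ones, then `L 2` twos, then `L 3` threes, and so on
(indexed from `1`): its `i`-th term is the least `k` with `i ≤ L₁ + ⋯ + L_k`.
The values `L 0` and `blockSeq L 0` play no role. -/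
noncomputable def blockSeq (L : ℕ → ℕ) (i : ℕ) : ℕ :=
  sInf {k : ℕ | i ≤ ∑ j ∈ Finset.Icc 1 k, L j}

/-- The growth conditions on block lengths `L₁, L₂, …`.  The lower bounds on the ratios
`L_k / (L₁ + ⋯ + L_{k'})` and `L_k / (L_{k'+1} + ⋯ + L_{k-1})` are cleared of denominators,
so that a bound with an empty sum in the denominator holds trivially.
`2 ≤ k` only ensures that `k / log k` makes sense. -/
def BlockGrowth (L : ℕ → ℕ) : Prop :=
  ∃ ε : ℝ, 0 < ε ∧ ∃ r : ℝ, 0 < r ∧ ∃ k₀ : ℕ, ∀ k k' : ℕ,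
    2 ≤ k → 1 ≤ k' → k₀ ≤ k → k₀ ≤ k' →
    (k : ℝ) - (k' : ℝ) ≥ (k : ℝ) / Real.log k - 2 →
      (L k : ℝ) ≥ (2 + ε) * Real.log k * ∑ j ∈ Finset.Icc 1 k', (L j : ℝ) ∧
      (L k : ℝ) ≥ 2 * r * ∑ j ∈ Finset.Ioo k' k, (L j : ℝ) ∧
      (L k : ℝ) ≥ (k : ℝ) ^ 4

/-- The number of indices `i ≥ 1` at which the sequence `a` takes the value `k`. -/
noncomputable def blockLength (a : ℕ → ℕ) (k : ℕ) : ℕ :=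
  Set.ncard {i : ℕ | 1 ≤ i ∧ a i = k}

/-- `a_i = ⌊(log_γ i)^β⌋`, `i ≥ 1`. -/
noncomputable def floorLogSeq (γ β : ℝ) (i : ℕ) : ℕ :=
  ⌊(Real.logb γ i) ^ β⌋₊

/-- `a_i = ⌈log_γ i⌉`, `i ≥ 1`. -/
noncomputable def ceilLogSeq (γ : ℝ) (i : ℕ) : ℕ :=
  ⌈Real.logb γ i⌉₊

/-!
While the walk uses the steps `k - 1` and then `k`, with `k` odd, it visits zero with conditional
probability at least `c / k`, provided it starts from height at most `C k √L_k`. Say it starts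
below zero, at `s`. The steps `±(k - 1)` are `∓1` modulo `k`, and `2` is invertible modulo `k`, so
the bound `c / √n` on the binomial weights near the centre shows that with probability at least
`c / k` the first block ends in `k ℤ`, still below zero and not much lower than before. With
probability bounded below the second block then climbs back above zero, and a walk on `k ℤ` with
steps `±k` cannot jump over zero.

By Chebyshev's inequality each starting condition fails with probability at most `M / C ^ 2`. Since
`∑ c / k` diverges over odd `k`, Lévy's conditional Borel–Cantelli lemma and Markov's inequality for
the weighted number of failures bound the probability of finitely many zeros by `M / C ^ 2`; let
`C → ∞`.
-/

/-! ### Binomial coefficients near the centre -/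

lemma sixteen_pow_le_mul_centralBinom_sq (p : ℕ) :
    16 ^ (p + 1) ≤ 4 * (p + 1) * (p + 1).centralBinom ^ 2 := by
  induction p with
  | zero => simp [Nat.centralBinom]
  | succ p ih =>
    refine Nat.le_of_mul_le_mul_left ?_ (by positivity : 0 < p + 2)
    calc (p + 2) * 16 ^ (p + 2) = 16 * (p + 2) * 16 ^ (p + 1) := by ring
      _ ≤ 16 * (p + 2) * (4 * (p + 1) * (p + 1).centralBinom ^ 2) := by gcongr
      _ = 16 * (4 * (p + 1) * (p + 2)) * (p + 1).centralBinom ^ 2 := by ring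
      _ ≤ 16 * (2 * (p + 1) + 1) ^ 2 * (p + 1).centralBinom ^ 2 := by gcongr; nlinarith
      _ = 4 * (2 * (2 * (p + 1) + 1) * (p + 1).centralBinom) ^ 2 := by ring
      _ = 4 * ((p + 2) * (p + 2).centralBinom) ^ 2 := by
        rw [← Nat.succ_mul_centralBinom_succ (p + 1)]
      _ = (p + 2) * (4 * (p + 2) * (p + 2).centralBinom ^ 2) := by ring

lemma centralBinom_succ_eq_two_mul_choose (p : ℕ) :
    (p + 1).centralBinom = 2 * (2 * p + 1).choose p := by
  rw [Nat.centralBinom, show 2 * (p + 1) = (2 * p + 1) + 1 by ring, Nat.choose_succ_succ,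
    Nat.choose_symm_half]
  ring

lemma four_pow_le_mul_choose_half_sq {n : ℕ} (hn : 1 ≤ n) :
    4 ^ n ≤ 4 * n * n.choose (n / 2) ^ 2 := by
  rcases Nat.even_or_odd' n with ⟨p, rfl | rfl⟩
  · obtain ⟨q, rfl⟩ : ∃ q, p = q + 1 := ⟨p - 1, by lia⟩
    have central := sixteen_pow_le_mul_centralBinom_sq q
    rw [Nat.centralBinom] at central
    rw [Nat.mul_div_cancel_left _ two_pos, pow_mul, show 4 ^ 2 = 16 by norm_num]
    nlinarith
  · have central := sixteen_pow_le_mul_centralBinom_sq p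
    rw [centralBinom_succ_eq_two_mul_choose] at central
    have pow_eq : 4 ^ (2 * p + 1) * 4 = 16 ^ (p + 1) := by
      rw [← pow_succ, show (16 : ℕ) = 4 ^ 2 by norm_num, ← pow_mul]
      congr 1
    rw [show (2 * p + 1) / 2 = p by lia]
    nlinarith [Nat.zero_le (p * (2 * p + 1).choose p ^ 2)]

lemma one_div_two_mul_sqrt_le_choose_half {n : ℕ} (hn : 1 ≤ n) :
    1 / (2 * √n) ≤ (n.choose (n / 2) : ℝ) / 2 ^ n := by
  have hn_pos : (0 : ℝ) < n := by exact_mod_cast hn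
  rw [div_le_div_iff₀ (by positivity) (by positivity), one_mul]
  refine (sq_le_sq₀ (by positivity) (by positivity)).1 ?_
  calc ((2 : ℝ) ^ n) ^ 2 = 4 ^ n := by rw [← pow_mul, mul_comm, pow_mul]; norm_num
    _ ≤ 4 * n * (n.choose (n / 2) : ℝ) ^ 2 := by
      exact_mod_cast four_pow_le_mul_choose_half_sq hn
    _ = (n.choose (n / 2) * (2 * √n)) ^ 2 := by
      rw [mul_pow, mul_pow, Real.sq_sqrt hn_pos.le]; ring

lemma choose_half_mul_pow_le_choose_half_sub {n d : ℕ} {x : ℝ} (hd : d ≤ n / 2) (hx : x ≤ 1)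
    (hdx : 4 * d ≤ x * n) :
    n.choose (n / 2) * (1 - x) ^ d ≤ n.choose (n / 2 - d) := by
  induction d with
  | zero => simp
  | succ d ih =>
    have recursion := Nat.choose_succ_right_eq n (n / 2 - (d + 1))
    rw [show n / 2 - (d + 1) + 1 = n / 2 - d by lia] at recursion
    obtain ⟨q, hq⟩ : ∃ q, q = n - (n / 2 - (d + 1)) := ⟨_, rfl⟩
    rw [← hq] at recursion
    have q_pos : (0 : ℝ) < q := by exact_mod_cast (show 0 < q by lia)
    have q_le : (q : ℝ) ≤ (n / 2 - d : ℕ) + 2 * (d + 1) := by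
      exact_mod_cast (show q ≤ (n / 2 - d) + 2 * (d + 1) by lia)
    have le_two_mul_q : (n : ℝ) ≤ 2 * q := by exact_mod_cast (show n ≤ 2 * q by lia)
    have n_pos : (0 : ℝ) < n := by exact_mod_cast (show 0 < n by lia)
    push_cast at hdx
    have x_pos : 0 < x := pos_of_mul_pos_left (lt_of_lt_of_le (by positivity) hdx) n_pos.le
    have ratio : (1 - x) * q ≤ (n / 2 - d : ℕ) := by nlinarith
    refine le_of_mul_le_mul_right ?_ q_pos
    calc n.choose (n / 2) * (1 - x) ^ (d + 1) * q
        = (n.choose (n / 2) * (1 - x) ^ d) * ((1 - x) * q) := by ring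
      _ ≤ n.choose (n / 2 - d) * (n / 2 - d : ℕ) := by
        have ih := ih (by lia) (by linarith)
        have : 0 ≤ 1 - x := by linarith
        gcongr
      _ = n.choose (n / 2 - (d + 1)) * q := by exact_mod_cast recursion

lemma exp_neg_two_mul_le_one_sub {x : ℝ} (hx₀ : 0 ≤ x) (hx : x ≤ 1 / 2) :
    Real.exp (-(2 * x)) ≤ 1 - x := by
  rw [Real.exp_neg, inv_le_iff_one_le_mul₀ (Real.exp_pos _)]
  nlinarith [Real.add_one_le_exp (2 * x)]

lemma exists_div_sqrt_le_choose_half_sub {A : ℝ} (hA : 0 < A) :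
    ∃ c : ℝ, 0 < c ∧ ∀ᶠ n : ℕ in atTop, ∀ d : ℕ, d ≤ A * √n →
      d ≤ n / 2 ∧ c / √n ≤ (n.choose (n / 2 - d) : ℝ) / 2 ^ n := by
  refine ⟨Real.exp (-(8 * A ^ 2)) / 2, by positivity, ?_⟩
  have sqrt_large : ∀ᶠ n : ℕ in atTop, 8 * A ≤ √n :=
    (Real.tendsto_sqrt_atTop.comp tendsto_natCast_atTop_atTop).eventually_ge_atTop _
  filter_upwards [sqrt_large, eventually_ge_atTop 1] with n hn hn₁ d hd
  have n_pos : (0 : ℝ) < n := by exact_mod_cast hn₁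
  have sq_sqrt : √(n : ℝ) * √n = n := Real.mul_self_sqrt n_pos.le
  have eight_mul_le : (d : ℝ) * 8 ≤ n := by nlinarith
  have d_le : d ≤ n / 2 := by
    have : d * 8 ≤ n := by exact_mod_cast eight_mul_le
    lia
  refine ⟨d_le, ?_⟩
  obtain ⟨x, hx⟩ : ∃ x : ℝ, x = 4 * d / n := ⟨_, rfl⟩
  have x_mul : x * n = 4 * d := by rw [hx]; field_simp
  have x_nonneg : 0 ≤ x := by rw [hx]; positivity
  have x_le : x ≤ 1 / 2 := by nlinarith
  have x_mul_d : x * d ≤ 4 * A ^ 2 := by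
    rw [hx, div_mul_eq_mul_div, div_le_iff₀ n_pos]
    have : (d : ℝ) * d ≤ (A * √n) * (A * √n) := by gcongr
    nlinarith
  have exp_le : Real.exp (-(8 * A ^ 2)) ≤ (1 - x) ^ d :=
    calc Real.exp (-(8 * A ^ 2)) ≤ Real.exp (d * -(2 * x)) := Real.exp_le_exp.2 (by nlinarith)
      _ = Real.exp (-(2 * x)) ^ d := Real.exp_nat_mul _ _
      _ ≤ (1 - x) ^ d := by gcongr; exact exp_neg_two_mul_le_one_sub x_nonneg x_le
  calc Real.exp (-(8 * A ^ 2)) / 2 / √n = 1 / (2 * √n) * Real.exp (-(8 * A ^ 2)) := by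
        field_simp
    _ ≤ n.choose (n / 2) / 2 ^ n * (1 - x) ^ d :=
      mul_le_mul (one_div_two_mul_sqrt_le_choose_half hn₁) exp_le (by positivity) (by positivity)
    _ = n.choose (n / 2) * (1 - x) ^ d / 2 ^ n := by ring
    _ ≤ n.choose (n / 2 - d) / 2 ^ n := by
      gcongr
      exact choose_half_mul_pow_le_choose_half_sub d_le (by linarith) x_mul.ge

/-! ### The law of a sum of fair signs -/

/-- The probability that a sum of `n` independent fair signs lies in `B`: `h` of the signs are
positive with probability `n.choose h / 2 ^ n`, and the sum is then `2 * h - n`. -/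
noncomputable def signSumMass (n : ℕ) (B : Set ℝ) : ℝ :=
  (∑ h ∈ Finset.range (n + 1), (n.choose h : ℝ) * B.indicator 1 (2 * h - n : ℝ)) / 2 ^ n

lemma two_mul_half_sub_sub_eq {n d : ℕ} (hd : d ≤ n / 2) :
    2 * ((n / 2 - d : ℕ) : ℝ) - n = -(2 * d + (n % 2 : ℕ)) := by
  have h : 2 * (n / 2 - d) + 2 * d + n % 2 = n := by lia
  have h' : 2 * ((n / 2 - d : ℕ) : ℝ) + 2 * d + (n % 2 : ℕ) = n := by exact_mod_cast h
  linarith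

lemma exists_card_mul_le_signSumMass {A : ℝ} (hA : 0 < A) :
    ∃ c : ℝ, 0 < c ∧ ∀ᶠ n : ℕ in atTop, ∀ (T : Finset ℕ) (B : Set ℝ),
      (∀ d ∈ T, d ≤ A * √n ∧ -(2 * d + (n % 2 : ℕ) : ℝ) ∈ B) →
        T.card * (c / √n) ≤ signSumMass n B := by
  obtain ⟨c, c_pos, hc⟩ := exists_div_sqrt_le_choose_half_sub hA
  refine ⟨c, c_pos, hc.mono fun n hn T B hT => ?_⟩
  have inj : Set.InjOn (fun d => n / 2 - d) T := fun d hd e he (hde : n / 2 - d = n / 2 - e) => by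
    have := (hn d (hT d hd).1).1
    have := (hn e (hT e he).1).1
    lia
  have mem_B : ∀ d ∈ T, (2 * ((n / 2 - d : ℕ) : ℝ) - n) ∈ B := fun d hd => by
    rw [two_mul_half_sub_sub_eq (hn d (hT d hd).1).1]
    exact (hT d hd).2
  calc T.card * (c / √n) = ∑ _d ∈ T, c / √n := by simp
    _ ≤ ∑ d ∈ T, (n.choose (n / 2 - d) : ℝ) / 2 ^ n :=
      Finset.sum_le_sum fun d hd => (hn d (hT d hd).1).2
    _ = ∑ d ∈ T, (n.choose (n / 2 - d) : ℝ) *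
          B.indicator 1 (2 * ((n / 2 - d : ℕ) : ℝ) - n) / 2 ^ n :=
      Finset.sum_congr rfl fun d hd => by simp [Set.indicator_of_mem (mem_B d hd)]
    _ = ∑ h ∈ T.image fun d => n / 2 - d,
          (n.choose h : ℝ) * B.indicator 1 (2 * (h : ℝ) - n) / 2 ^ n := by
      rw [Finset.sum_image inj]
    _ ≤ ∑ h ∈ Finset.range (n + 1), (n.choose h : ℝ) * B.indicator 1 (2 * (h : ℝ) - n) / 2 ^ n := by
      refine Finset.sum_le_sum_of_subset_of_nonneg ?_ fun h _ _ => ?_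
      · intro h hh
        obtain ⟨d, -, rfl⟩ := Finset.mem_image.1 hh
        exact Finset.mem_range.2 (by lia)
      · have : (0 : ℝ) ≤ B.indicator 1 (2 * (h : ℝ) - n) :=
          Set.indicator_nonneg (fun _ _ => zero_le_one) _
        positivity
    _ = signSumMass n B := by rw [signSumMass, Finset.sum_div]

lemma exists_le_signSumMass_Iic {K : ℝ} (hK : 0 < K) :
    ∃ c : ℝ, 0 < c ∧ ∀ᶠ n : ℕ in atTop, c ≤ signSumMass n (Set.Iic (-(K * √n))) := by
  obtain ⟨c, c_pos, hc⟩ := exists_card_mul_le_signSumMass (A := K + 2) (by positivity)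
  refine ⟨c, c_pos, ?_⟩
  filter_upwards [hc, eventually_ge_atTop 1] with n hn hn₁
  have one_le_sqrt : 1 ≤ √(n : ℝ) := Real.one_le_sqrt.2 (by exact_mod_cast hn₁)
  have sqrt_lt := Nat.lt_floor_add_one √(n : ℝ)
  have floor_le := Nat.floor_le (Real.sqrt_nonneg (n : ℝ))
  have le_ceil := Nat.le_ceil (K * √n)
  have ceil_lt := Nat.ceil_lt_add_one (by positivity : 0 ≤ K * √n)
  refine le_trans ?_ (hn (Finset.Icc ⌈K * √n⌉₊ (⌈K * √n⌉₊ + ⌊√(n : ℝ)⌋₊)) _ fun d hd => ?_)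
  · rw [Nat.card_Icc, add_assoc, Nat.add_sub_cancel_left, mul_div_assoc',
      le_div_iff₀ (by positivity), mul_comm]
    push_cast
    gcongr
  · obtain ⟨le_d, d_le⟩ := Finset.mem_Icc.1 hd
    have le_d : (⌈K * √n⌉₊ : ℝ) ≤ d := by exact_mod_cast le_d
    have d_le : (d : ℝ) ≤ ⌈K * √n⌉₊ + ⌊√(n : ℝ)⌋₊ := by exact_mod_cast d_le
    refine ⟨by linarith, Set.mem_Iic.2 ?_⟩
    have : (0 : ℝ) ≤ (n % 2 : ℕ) := by positivity
    linarith

/-- The integers in `[-r, 0]` congruent to `s` modulo `k`, as real numbers. A walk at height `s`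
which then makes steps `±(k - 1)` reaches `k ℤ` exactly when the signs add up to `s` modulo `k`. -/
def residueWindow (k : ℕ) (r : ℝ) (s : ℤ) : Set ℝ :=
  (fun u : ℤ => (u : ℝ)) '' {u | u ≡ s [ZMOD k] ∧ -r ≤ u ∧ u ≤ 0}

lemma measurableSet_residueWindow (k : ℕ) (r : ℝ) (s : ℤ) :
    MeasurableSet (residueWindow k r s) :=
  ((Set.to_countable _).image _).measurableSet

lemma exists_nat_two_mul_modEq {k : ℕ} (hk : Odd k) (b : ℤ) :
    ∃ v : ℕ, 2 * (v : ℤ) ≡ b [ZMOD k] := by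
  have k_ne : (k : ℤ) ≠ 0 := by exact_mod_cast hk.pos.ne'
  obtain ⟨t, rfl⟩ := hk
  refine ⟨(b * (t + 1) % (2 * t + 1 : ℕ)).toNat, ?_⟩
  rw [Int.toNat_of_nonneg (Int.emod_nonneg _ k_ne)]
  calc 2 * (b * (t + 1) % (2 * t + 1 : ℕ)) ≡ 2 * (b * (t + 1)) [ZMOD (2 * t + 1 : ℕ)] :=
        (Int.mod_modEq _ _).mul_left 2
    _ = b + (2 * t + 1 : ℕ) * b := by push_cast; ring
    _ ≡ b [ZMOD (2 * t + 1 : ℕ)] := by simp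

lemma le_two_mul_card_filter_modEq {k D : ℕ} (v : ℕ) (hk : 0 < k) (hkD : k ≤ D) :
    D ≤ 2 * k * ((Finset.range D).filter (· ≡ v [MOD k])).card := by
  have count_ge : D / k ≤ ((Finset.range D).filter (· ≡ v [MOD k])).card := by
    rw [← Nat.count_eq_card_filter_range, Nat.count_modEq_card D hk]
    exact Nat.le_add_right _ _
  have one_le : 1 ≤ D / k := (Nat.one_le_div_iff hk).2 hkD
  calc D = k * (D / k) + D % k := (Nat.div_add_mod D k).symm
    _ ≤ k * (D / k) + k * (D / k) := by
      gcongr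
      exact (Nat.mod_lt D hk).le.trans (Nat.le_mul_of_pos_right k one_le)
    _ = 2 * k * (D / k) := by ring
    _ ≤ _ := by gcongr

lemma exists_div_le_signSumMass_residueWindow :
    ∃ c : ℝ, 0 < c ∧ ∀ᶠ n : ℕ in atTop, ∀ k : ℕ, Odd k → k ^ 2 ≤ n → ∀ s : ℤ,
      c / k ≤ signSumMass n (residueWindow k (3 * √n) s) := by
  obtain ⟨c, c_pos, hc⟩ := exists_card_mul_le_signSumMass one_pos
  refine ⟨c / 2, by positivity, ?_⟩
  filter_upwards [hc, eventually_ge_atTop 1] with n hn hn₁ k k_odd hk s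
  have k_pos : (0 : ℝ) < k := by exact_mod_cast k_odd.pos
  have one_le_sqrt : 1 ≤ √(n : ℝ) := Real.one_le_sqrt.2 (by exact_mod_cast hn₁)
  obtain ⟨v, hv⟩ := exists_nat_two_mul_modEq k_odd (-s - (n % 2 : ℕ))
  refine le_trans ?_ (hn ((Finset.range (n.sqrt + 1)).filter (· ≡ v [MOD k])) _ fun d hd => ?_)
  · have sqrt_le : √(n : ℝ) ≤ 2 * k * ((Finset.range (n.sqrt + 1)).filter (· ≡ v [MOD k])).card :=
      Real.real_sqrt_le_nat_sqrt_succ.trans <| by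
        exact_mod_cast le_two_mul_card_filter_modEq v k_odd.pos
          ((Nat.le_sqrt'.2 hk).trans n.sqrt.le_succ)
    rw [div_div, mul_div_assoc', div_le_div_iff₀ (by positivity) (by positivity)]
    nlinarith
  · obtain ⟨d_lt, d_modEq⟩ := Finset.mem_filter.1 hd
    have d_le : (d : ℝ) ≤ √n := le_trans
      (by exact_mod_cast Nat.lt_succ_iff.1 (Finset.mem_range.1 d_lt)) Real.nat_sqrt_le_real_sqrt
    refine ⟨by simpa using d_le, -(2 * d + (n % 2 : ℕ)), ⟨?_, ?_, by lia⟩, by push_cast; rfl⟩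
    · have two_mul_d : 2 * (d : ℤ) ≡ -s - (n % 2 : ℕ) [ZMOD k] :=
        ((Int.natCast_modEq_iff.2 d_modEq).mul_left 2).trans hv
      simpa using (two_mul_d.add_right (n % 2 : ℕ)).neg
    · have : ((n % 2 : ℕ) : ℝ) ≤ 1 := by exact_mod_cast Nat.lt_succ_iff.1 (n.mod_lt two_pos)
      simp only [Int.cast_neg, Int.cast_add, Int.cast_mul, Int.cast_ofNat, Int.cast_natCast]
      linarith

/-! ### Rademacher sequences -/

section StepSigma

variable {Ω : Type*} (X : ℕ → Ω → ℝ)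

/-- The σ-algebra generated by the variables `X i` with `i ∈ I` and `i ≥ 1`. -/
abbrev stepSigma (I : Set ℕ) : MeasurableSpace Ω :=
  ⨆ i ∈ {i | i + 1 ∈ I}, (inferInstance : MeasurableSpace ℝ).comap (X (i + 1))

lemma stepSigma_mono : Monotone (stepSigma X) :=
  fun _ _ hIJ => biSup_mono fun _ hi => hIJ hi

lemma stepSigma_neg (I : Set ℕ) : stepSigma (-X) I = stepSigma X I := by
  have comap_neg : ∀ f : Ω → ℝ, (inferInstance : MeasurableSpace ℝ).comap (-f) =
      (inferInstance : MeasurableSpace ℝ).comap f := fun f => by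
    rw [show -f = MeasurableEquiv.neg ℝ ∘ f from rfl, ← MeasurableSpace.comap_comp,
      (MeasurableEquiv.neg ℝ).measurableEmbedding.comap_eq]
  simp only [stepSigma, Pi.neg_apply, comap_neg]

variable {X} {I : Set ℕ}

lemma measurable_stepSigma {i : ℕ} (hi : i ∈ I) (hi₁ : 1 ≤ i) :
    Measurable[stepSigma X I] (X i) := by
  obtain ⟨j, rfl⟩ : ∃ j, i = j + 1 := ⟨i - 1, by lia⟩
  exact measurable_iff_comap_le.2 (le_iSup₂_of_le j hi le_rfl)

lemma measurable_sum_stepSigma {J : Finset ℕ} (hJ : ∀ i ∈ J, i ∈ I ∧ 1 ≤ i) :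
    Measurable[stepSigma X I] fun ω => ∑ i ∈ J, X i ω :=
  @Finset.measurable_fun_sum _ _ _ _ _ _ (stepSigma X I) _ _ fun i hi =>
    measurable_stepSigma (hJ i hi).1 (hJ i hi).2

lemma measurable_aWalk_stepSigma (a : ℕ → ℝ) {n p : ℕ} (hnp : n ≤ p) :
    Measurable[stepSigma X (Set.Icc 1 p)] (aWalk a X n) := by
  refine @Finset.measurable_fun_sum _ _ _ _ _ _ (stepSigma X _) _ _ fun i hi => ?_
  obtain ⟨hi₁, hin⟩ := Finset.mem_Icc.1 hi
  exact (measurable_const_mul (a i)).comp (measurable_stepSigma ⟨hi₁, hin.trans hnp⟩ hi₁)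

end StepSigma

namespace IsRademacherSeq

variable {Ω : Type*} [mΩ : MeasurableSpace Ω] {μ : Measure Ω} {X : ℕ → Ω → ℝ}

lemma stepSigma_le (hX : IsRademacherSeq μ X) (I : Set ℕ) : stepSigma X I ≤ mΩ :=
  iSup₂_le fun i _ => (hX.measurable (i + 1) (by lia)).comap_le

lemma indep_stepSigma (hX : IsRademacherSeq μ X) {I J : Set ℕ} (h : Disjoint I J) :
    Indep (stepSigma X I) (stepSigma X J) μ :=
  indep_iSup_of_disjoint (fun i => (hX.measurable (i + 1) (by lia)).comap_le) hX.indep.iIndep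
    (h.preimage (· + 1))

lemma indepFun (hX : IsRademacherSeq μ X) {i j : ℕ} (hi : 1 ≤ i) (hj : 1 ≤ j) (hij : i ≠ j) :
    IndepFun (X i) (X j) μ := by
  obtain ⟨i, rfl⟩ : ∃ k, i = k + 1 := ⟨i - 1, by lia⟩
  obtain ⟨j, rfl⟩ : ∃ k, j = k + 1 := ⟨j - 1, by lia⟩
  exact hX.indep.indepFun (by simpa using hij)

lemma neg (hX : IsRademacherSeq μ X) : IsRademacherSeq μ (-X) where
  measurable i hi := (hX.measurable i hi).neg
  indep := hX.indep.comp (fun _ x => -x) fun _ => measurable_neg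
  prob_one i hi := by simpa [neg_eq_iff_eq_neg] using hX.prob_neg_one i hi
  prob_neg_one i hi := by simpa using hX.prob_one i hi

variable [IsProbabilityMeasure μ]

lemma ae_eq_or (hX : IsRademacherSeq μ X) {i : ℕ} (hi : 1 ≤ i) :
    ∀ᵐ ω ∂μ, X i ω = 1 ∨ X i ω = -1 := by
  have meas_one : MeasurableSet {ω | X i ω = 1} :=
    hX.measurable i hi (measurableSet_singleton 1)
  have meas_neg_one : MeasurableSet {ω | X i ω = -1} :=
    hX.measurable i hi (measurableSet_singleton (-1))
  have disj : Disjoint {ω | X i ω = 1} {ω | X i ω = -1} :=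
    Set.disjoint_left.2 fun ω (h₁ : X i ω = 1) (h₂ : X i ω = -1) => by linarith
  refine (mem_ae_iff_prob_eq_one (meas_one.union meas_neg_one)).2 ?_
  rw [measure_union disj meas_neg_one, hX.prob_one i hi, hX.prob_neg_one i hi,
    ENNReal.add_halves]

lemma ae_forall_eq_or (hX : IsRademacherSeq μ X) :
    ∀ᵐ ω ∂μ, ∀ i, 1 ≤ i → X i ω = 1 ∨ X i ω = -1 :=
  ae_all_iff.2 fun _ => ae_all_iff.2 hX.ae_eq_or

lemma measureReal_sum_insert (hX : IsRademacherSeq μ X) {i : ℕ} {I : Finset ℕ} (hi : i ∉ I)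
    (hI : ∀ j ∈ insert i I, 1 ≤ j) {B : Set ℝ} (hB : MeasurableSet B) :
    μ.real {ω | ∑ j ∈ insert i I, X j ω ∈ B} =
      (μ.real {ω | ∑ j ∈ I, X j ω ∈ (-1 + ·) ⁻¹' B} +
        μ.real {ω | ∑ j ∈ I, X j ω ∈ (1 + ·) ⁻¹' B}) / 2 := by
  have hi₁ : 1 ≤ i := hI i (Finset.mem_insert_self _ _)
  have meas_sum : Measurable[stepSigma X I] fun ω => ∑ j ∈ I, X j ω :=
    measurable_sum_stepSigma fun j hj => ⟨hj, hI j (Finset.mem_insert_of_mem hj)⟩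
  have meas_Xi : Measurable[stepSigma X {i}] (X i) := measurable_stepSigma rfl hi₁
  have indep := (Indep_iff _ _ μ).1
    (hX.indep_stepSigma (I := {i}) (J := (I : Set ℕ)) (by simpa using hi))
  have meas_set (x : ℝ) : MeasurableSet[stepSigma X I] {ω | ∑ j ∈ I, X j ω ∈ (x + ·) ⁻¹' B} :=
    meas_sum (measurable_const_add x hB)
  have meas_eq (x : ℝ) : MeasurableSet[stepSigma X {i}] {ω | X i ω = x} :=
    meas_Xi (measurableSet_singleton x)
  have prod (x : ℝ) (hx : μ {ω | X i ω = x} = 1 / 2) :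
      μ.real ({ω | X i ω = x} ∩ {ω | ∑ j ∈ I, X j ω ∈ (x + ·) ⁻¹' B}) =
        μ.real {ω | ∑ j ∈ I, X j ω ∈ (x + ·) ⁻¹' B} / 2 := by
    rw [Measure.real, indep _ _ (meas_eq x) (meas_set x), hx, ENNReal.toReal_mul, Measure.real]
    rw [one_div, ENNReal.toReal_inv, ENNReal.toReal_ofNat, inv_mul_eq_div]
  have split : {ω | ∑ j ∈ insert i I, X j ω ∈ B} =ᵐ[μ]
      ({ω | X i ω = -1} ∩ {ω | ∑ j ∈ I, X j ω ∈ (-1 + ·) ⁻¹' B} ∪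
        {ω | X i ω = 1} ∩ {ω | ∑ j ∈ I, X j ω ∈ (1 + ·) ⁻¹' B} : Set Ω) := by
    refine eventuallyEq_set.2 ?_
    filter_upwards [hX.ae_eq_or hi₁] with ω hω
    rcases hω with h | h <;> simp [Finset.sum_insert hi, h] <;> norm_num
  rw [measureReal_congr split, measureReal_union, prod _ (hX.prob_neg_one i hi₁),
    prod _ (hX.prob_one i hi₁), add_div]
  · exact Set.disjoint_left.2 fun ω h₁ h₂ => by
      have : (-1 : ℝ) = 1 := h₁.1.symm.trans h₂.1
      norm_num at this
  · exact (hX.stepSigma_le _ _ (meas_eq 1)).inter (hX.stepSigma_le _ _ (meas_set 1))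

end IsRademacherSeq

lemma sum_choose_succ_mul_sign (F : ℝ → ℝ) (n : ℕ) :
    ∑ h ∈ Finset.range (n + 2), ((n + 1).choose h : ℝ) * F (2 * h - (n + 1 : ℕ)) =
      ∑ h ∈ Finset.range (n + 1), (n.choose h : ℝ) * F (-1 + (2 * h - n)) +
        ∑ h ∈ Finset.range (n + 1), (n.choose h : ℝ) * F (1 + (2 * h - n)) := by
  have pascal := Finset.sum_choose_succ_mul (fun i j : ℕ => F (i - j)) n
  convert pascal using 1
  · refine Finset.sum_congr rfl fun h hh => ?_
    rw [Nat.cast_sub (Nat.lt_succ_iff.1 (Finset.mem_range.1 hh))]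
    ring_nf
  · congr 1 <;> refine Finset.sum_congr rfl fun h hh => ?_
    · rw [Nat.cast_sub (Finset.mem_range.1 hh).le]
      push_cast
      ring_nf
    · rw [Nat.cast_sub (Nat.lt_succ_iff.1 (Finset.mem_range.1 hh))]
      push_cast
      ring_nf

lemma signSumMass_succ (n : ℕ) (B : Set ℝ) :
    signSumMass (n + 1) B =
      (signSumMass n ((-1 + ·) ⁻¹' B) + signSumMass n ((1 + ·) ⁻¹' B)) / 2 := by
  rw [signSumMass, sum_choose_succ_mul_sign, pow_succ, ← div_div, add_div]
  rfl

namespace IsRademacherSeq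

variable {Ω : Type*} [mΩ : MeasurableSpace Ω] {μ : Measure Ω} [IsProbabilityMeasure μ]
  {X : ℕ → Ω → ℝ}

lemma measureReal_sum_mem (hX : IsRademacherSeq μ X) {I : Finset ℕ} (hI : ∀ i ∈ I, 1 ≤ i)
    {B : Set ℝ} (hB : MeasurableSet B) :
    μ.real {ω | ∑ i ∈ I, X i ω ∈ B} = signSumMass I.card B := by
  induction I using Finset.induction_on generalizing B with
  | empty => by_cases h : (0 : ℝ) ∈ B <;> simp [signSumMass, h]
  | insert i I hi ih =>
    have hI' : ∀ j ∈ I, 1 ≤ j := fun j hj => hI j (Finset.mem_insert_of_mem hj)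
    rw [hX.measureReal_sum_insert hi hI hB, ih hI' (measurable_const_add _ hB),
      ih hI' (measurable_const_add _ hB), Finset.card_insert_of_notMem hi, signSumMass_succ]

lemma memLp_const_mul (hX : IsRademacherSeq μ X) (c : ℝ) {i : ℕ} (hi : 1 ≤ i) :
    MemLp (fun ω => c * X i ω) 2 μ := by
  refine MemLp.of_bound ((hX.measurable i hi).const_mul c).aestronglyMeasurable |c| ?_
  filter_upwards [hX.ae_eq_or hi] with ω hω
  rcases hω with h | h <;> simp [h]

lemma integral_eq_zero (hX : IsRademacherSeq μ X) {i : ℕ} (hi : 1 ≤ i) : ∫ ω, X i ω ∂μ = 0 := by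
  have meas_one : MeasurableSet {ω | X i ω = 1} :=
    hX.measurable i hi (measurableSet_singleton 1)
  have eq_indicator : X i =ᵐ[μ] fun ω => 2 * {ω | X i ω = 1}.indicator 1 ω - 1 := by
    filter_upwards [hX.ae_eq_or hi] with ω hω
    rcases hω with h | h <;> simp [Set.indicator, h] <;> norm_num
  have integrable : Integrable ({ω | X i ω = 1}.indicator (1 : Ω → ℝ)) μ :=
    (integrable_const 1).indicator meas_one
  rw [integral_congr_ae eq_indicator, integral_sub (integrable.const_mul 2) (integrable_const 1),
    integral_const_mul, integral_indicator_one meas_one, Measure.real, hX.prob_one i hi]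
  simp

lemma variance_eq_one (hX : IsRademacherSeq μ X) {i : ℕ} (hi : 1 ≤ i) : Var[X i; μ] = 1 := by
  have sq_eq : (fun ω => X i ω ^ 2) =ᵐ[μ] fun _ => 1 := by
    filter_upwards [hX.ae_eq_or hi] with ω hω
    rcases hω with h | h <;> simp [h]
  rw [variance_of_integral_eq_zero (hX.measurable i hi).aemeasurable (hX.integral_eq_zero hi),
    integral_congr_ae sq_eq]
  simp

lemma integral_aWalk (hX : IsRademacherSeq μ X) (a : ℕ → ℝ) (n : ℕ) :
    ∫ ω, aWalk a X n ω ∂μ = 0 := by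
  unfold aWalk
  rw [integral_finsetSum _ fun i hi =>
    (hX.memLp_const_mul _ (Finset.mem_Icc.1 hi).1).integrable one_le_two]
  exact Finset.sum_eq_zero fun i hi => by
    rw [integral_const_mul, hX.integral_eq_zero (Finset.mem_Icc.1 hi).1, mul_zero]

lemma memLp_aWalk (hX : IsRademacherSeq μ X) (a : ℕ → ℝ) (n : ℕ) : MemLp (aWalk a X n) 2 μ :=
  memLp_finsetSum _ fun _ hi => hX.memLp_const_mul _ (Finset.mem_Icc.1 hi).1

lemma variance_aWalk (hX : IsRademacherSeq μ X) (a : ℕ → ℝ) (n : ℕ) :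
    Var[aWalk a X n; μ] = ∑ i ∈ Finset.Icc 1 n, a i ^ 2 := by
  have eq_sum : aWalk a X n = ∑ i ∈ Finset.Icc 1 n, fun ω => a i * X i ω := by
    ext ω
    simp [aWalk]
  rw [eq_sum, IndepFun.variance_sum]
  · exact Finset.sum_congr rfl fun i hi => by
      rw [variance_const_mul, hX.variance_eq_one (Finset.mem_Icc.1 hi).1, mul_one]
  · exact fun i hi => hX.memLp_const_mul _ (Finset.mem_Icc.1 hi).1
  · exact fun i hi j hj hij => (hX.indepFun (Finset.mem_Icc.1 hi).1 (Finset.mem_Icc.1 hj).1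
      hij).comp (measurable_const_mul _) (measurable_const_mul _)

lemma measureReal_le_abs_aWalk_le (hX : IsRademacherSeq μ X) (a : ℕ → ℝ) (n : ℕ) {t : ℝ}
    (ht : 0 < t) :
    μ.real {ω | t ≤ |aWalk a X n ω|} ≤ (∑ i ∈ Finset.Icc 1 n, a i ^ 2) / t ^ 2 := by
  have chebyshev := meas_ge_le_variance_div_sq (hX.memLp_aWalk a n) ht
  simp only [hX.integral_aWalk, sub_zero, hX.variance_aWalk] at chebyshev
  exact ENNReal.toReal_le_of_le_ofReal (by positivity) chebyshev

end IsRademacherSeq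

/-! ### Crossing zero during two consecutive blocks -/

lemma exists_eq_zero_of_step_le_one {y : ℕ → ℤ} {p q : ℕ} (hpq : p ≤ q)
    (step : ∀ n, p ≤ n → n < q → y (n + 1) ≤ y n + 1) (hp : y p ≤ 0) (hq : 0 ≤ y q) :
    ∃ n ∈ Set.Icc p q, y n = 0 := by
  induction q, hpq using Nat.le_induction with
  | base => exact ⟨p, by simp, le_antisymm hp hq⟩
  | succ q hpq ih =>
    rcases le_or_gt 0 (y q) with hq₀ | hq₀
    · obtain ⟨n, ⟨hpn, hnq⟩, hn⟩ := ih (fun n h₁ h₂ => step n h₁ (h₂.trans q.lt_succ_self)) hq₀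
      exact ⟨n, ⟨hpn, hnq.trans q.le_succ⟩, hn⟩
    · exact ⟨q + 1, ⟨hpq.trans q.le_succ, le_rfl⟩, by
        have := step q hpq q.lt_succ_self
        lia⟩

section Walk

variable {Ω : Type*} {X : ℕ → Ω → ℝ}

lemma aWalk_neg (a : ℕ → ℝ) (n : ℕ) (ω : Ω) : aWalk a (-X) n ω = -aWalk a X n ω := by
  simp [aWalk]

lemma aWalk_eq_add_mul_sum {a : ℕ → ℝ} {p q : ℕ} {b : ℝ} (hpq : p ≤ q)
    (ha : ∀ i ∈ Finset.Ioc p q, a i = b) (ω : Ω) :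
    aWalk a X q ω = aWalk a X p ω + b * ∑ i ∈ Finset.Ioc p q, X i ω := by
  rw [aWalk, aWalk, ← zero_add 1, Finset.Icc_add_one_left_eq_Ioc, Finset.Icc_add_one_left_eq_Ioc,
    ← Finset.sum_Ioc_consecutive _ p.zero_le hpq, Finset.mul_sum]
  exact congrArg _ (Finset.sum_congr rfl fun i hi => by rw [ha i hi])

lemma exists_int_signs {ω : Ω} (hω : ∀ i, 1 ≤ i → X i ω = 1 ∨ X i ω = -1) :
    ∃ e : ℕ → ℤ, ∀ i, 1 ≤ i → X i ω = e i ∧ e i ≤ 1 := by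
  have pointwise : ∀ i, ∃ e : ℤ, 1 ≤ i → X i ω = e ∧ e ≤ 1 := fun i => by
    by_cases hi : 1 ≤ i
    · rcases hω i hi with h | h
      · exact ⟨1, fun _ => by simp [h]⟩
      · exact ⟨-1, fun _ => by simp [h]⟩
    · exact ⟨0, fun h => absurd h hi⟩
  exact Classical.skolem.1 pointwise

lemma exists_int_eq_aWalk {ω : Ω} (hω : ∀ i, 1 ≤ i → X i ω = 1 ∨ X i ω = -1) (a : ℕ → ℕ) (n : ℕ) :
    ∃ s : ℤ, aWalk (fun i => (a i : ℝ)) X n ω = s := by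
  obtain ⟨e, he⟩ := exists_int_signs hω
  refine ⟨∑ i ∈ Finset.Icc 1 n, a i * e i, ?_⟩
  push_cast
  exact Finset.sum_congr rfl fun i hi => by rw [(he i (Finset.mem_Icc.1 hi).1).1]

lemma exists_aWalk_eq_zero_of_steps_eq {a : ℕ → ℝ} {p q : ℕ} {k : ℝ} (hk : 0 < k) (hpq : p ≤ q)
    (ha : ∀ i ∈ Finset.Ioc p q, a i = k) {ω : Ω} (hω : ∀ i, 1 ≤ i → X i ω = 1 ∨ X i ω = -1)
    {x : ℤ} (hx : aWalk a X p ω = k * x) (hp : aWalk a X p ω ≤ 0) (hq : 0 ≤ aWalk a X q ω) :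
    ∃ n ∈ Set.Icc p q, aWalk a X n ω = 0 := by
  obtain ⟨e, he⟩ := exists_int_signs hω
  have walk_eq : ∀ n, p ≤ n → n ≤ q →
      aWalk a X n ω = k * (x + ∑ i ∈ Finset.Ioc p n, e i : ℤ) := fun n hpn hnq => by
    have sum_eq : ∑ i ∈ Finset.Ioc p n, X i ω = ∑ i ∈ Finset.Ioc p n, (e i : ℝ) :=
      Finset.sum_congr rfl fun i hi =>
        (he i ((Nat.zero_le p).trans_lt (Finset.mem_Ioc.1 hi).1)).1
    rw [aWalk_eq_add_mul_sum hpn fun i hi => ha i (Finset.Ioc_subset_Ioc_right hnq hi), hx, sum_eq]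
    push_cast
    ring
  obtain ⟨n, hn, height_eq⟩ := exists_eq_zero_of_step_le_one
    (y := fun n => x + ∑ i ∈ Finset.Ioc p n, e i) hpq
    (fun n hpn _ => by
      rw [Finset.sum_Ioc_succ_top hpn]
      linarith [(he (n + 1) n.succ_pos).2])
    (by
      rw [walk_eq p le_rfl hpq] at hp
      exact_mod_cast nonpos_of_mul_nonpos_right hp hk)
    (by
      rw [walk_eq q hpq le_rfl] at hq
      exact_mod_cast nonneg_of_mul_nonneg_right hq hk)
  exact ⟨n, hn, by rw [walk_eq n hn.1 hn.2, height_eq, Int.cast_zero, mul_zero]⟩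

/-- The event that the `a`-walk visits zero at some time in `[p, q]`. -/
def zeroIn (a : ℕ → ℕ) (X : ℕ → Ω → ℝ) (p q : ℕ) : Set Ω :=
  {ω | ∃ n ∈ Set.Icc p q, aWalk (fun i => (a i : ℝ)) X n ω = 0}

lemma zeroIn_neg (a : ℕ → ℕ) (p q : ℕ) : zeroIn a (-X) p q = zeroIn a X p q := by
  simp only [zeroIn, aWalk_neg, neg_eq_zero]

lemma measurableSet_zeroIn (a : ℕ → ℕ) (p q : ℕ) :
    MeasurableSet[stepSigma X (Set.Icc 1 q)] (zeroIn a X p q) := by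
  have eq_iUnion : zeroIn a X p q =
      ⋃ n ∈ Set.Icc p q, {ω | aWalk (fun i => (a i : ℝ)) X n ω = 0} := by
    ext ω
    simp only [zeroIn, Set.mem_ofPred_eq, Set.mem_iUnion, exists_prop]
  rw [eq_iUnion]
  exact MeasurableSet.biUnion (Set.to_countable _) fun n hn =>
    measurable_aWalk_stepSigma _ hn.2 (measurableSet_singleton 0)

/-- After time `p`, the sequence `a` has `m` entries `k - 1` followed by `n` entries `k`. -/
structure IsBlockPair (a : ℕ → ℕ) (p m n k : ℕ) : Prop where
  succ_eq_of_mem_fst : ∀ i ∈ Finset.Ioc p (p + m), a i + 1 = k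
  eq_of_mem_snd : ∀ i ∈ Finset.Ioc (p + m) (p + m + n), a i = k

/-- The event that the `m` signs after time `p` bring a walk with steps `±(k - 1)` from `s` to
`k ℤ` after a moderate descent, and that the next `n` signs add up to at least `K √n`. -/
def crossingEvent (X : ℕ → Ω → ℝ) (p m n k : ℕ) (K : ℝ) (s : ℤ) : Set Ω :=
  {ω | ∑ i ∈ Finset.Ioc p (p + m), X i ω ∈ residueWindow k (3 * √m) s} ∩
    {ω | K * √n ≤ ∑ i ∈ Finset.Ioc (p + m) (p + m + n), X i ω}

lemma measurableSet_crossingEvent_fst (p m k : ℕ) (s : ℤ) :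
    MeasurableSet[stepSigma X (Set.Ioc p (p + m))]
      {ω | ∑ i ∈ Finset.Ioc p (p + m), X i ω ∈ residueWindow k (3 * √m) s} :=
  measurable_sum_stepSigma
    (fun _ hi => ⟨Finset.mem_Ioc.1 hi, (Nat.zero_le p).trans_lt (Finset.mem_Ioc.1 hi).1⟩)
    (measurableSet_residueWindow _ _ _)

lemma measurableSet_crossingEvent_snd (p n : ℕ) (K : ℝ) :
    MeasurableSet[stepSigma X (Set.Ioc p (p + n))]
      {ω | K * √n ≤ ∑ i ∈ Finset.Ioc p (p + n), X i ω} :=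
  measurable_sum_stepSigma
    (fun _ hi => ⟨Finset.mem_Ioc.1 hi, (Nat.zero_le p).trans_lt (Finset.mem_Ioc.1 hi).1⟩)
    measurableSet_Ici

lemma measurableSet_crossingEvent (p m n k : ℕ) (K : ℝ) (s : ℤ) :
    MeasurableSet[stepSigma X (Set.Ioc p (p + m + n))] (crossingEvent X p m n k K s) :=
  MeasurableSet.inter
    (stepSigma_mono X (Set.Ioc_subset_Ioc_right (Nat.le_add_right _ _)) _
      (measurableSet_crossingEvent_fst p m k s))
    (stepSigma_mono X (Set.Ioc_subset_Ioc_left (Nat.le_add_right _ _)) _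
      (measurableSet_crossingEvent_snd (p + m) n K))

lemma IsBlockPair.mem_zeroIn_of_mem_crossingEvent {a : ℕ → ℕ} {p m n k : ℕ}
    (ha : IsBlockPair a p m n k) (hk : 1 ≤ k) {C M : ℝ} (hM : 0 ≤ M) (hmn : m ≤ M * n) {s : ℤ}
    (hs : s ≤ 0) (hsC : -(C * k * √n) ≤ s) {ω : Ω}
    (hω : ∀ i, 1 ≤ i → X i ω = 1 ∨ X i ω = -1)
    (hcross : ω ∈ crossingEvent X p m n k (C + 3 * √M) s)
    (hstart : aWalk (fun i => (a i : ℝ)) X p ω = s) :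
    ω ∈ zeroIn a X (p + m) (p + m + n) := by
  obtain ⟨⟨u, ⟨u_modEq, le_u, u_nonpos⟩, sum_eq⟩, le_sum⟩ := hcross
  simp only [Set.mem_ofPred_eq] at sum_eq le_sum
  have one_le_k : (1 : ℝ) ≤ k := by exact_mod_cast hk
  have s_nonpos : (s : ℝ) ≤ 0 := by exact_mod_cast hs
  have u_nonpos : (u : ℝ) ≤ 0 := by exact_mod_cast u_nonpos
  obtain ⟨x, hx⟩ : (k : ℤ) ∣ s + (k - 1) * u :=
    (by ring : s + (k - 1) * u = (s - u) + k * u) ▸ u_modEq.dvd.add (dvd_mul_right _ _)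
  have walk_mid : aWalk (fun i => (a i : ℝ)) X (p + m) ω = s + (k - 1) * u := by
    rw [aWalk_eq_add_mul_sum (b := k - 1) (Nat.le_add_right p m), hstart, ← sum_eq]
    exact fun i hi => by simp [← ha.succ_eq_of_mem_fst i hi]
  have snd_eq : ∀ i ∈ Finset.Ioc (p + m) (p + m + n), (a i : ℝ) = k := fun i hi => by
    rw [ha.eq_of_mem_snd i hi]
  refine exists_aWalk_eq_zero_of_steps_eq (x := x) (by positivity) (Nat.le_add_right _ n)
    snd_eq hω ?_ ?_ ?_
  · rw [walk_mid]
    exact_mod_cast hx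
  · rw [walk_mid]
    nlinarith
  · have sqrt_le : √(m : ℝ) ≤ √M * √n := by
      rw [← Real.sqrt_mul hM]
      exact Real.sqrt_le_sqrt hmn
    rw [aWalk_eq_add_mul_sum (Nat.le_add_right _ n) snd_eq, walk_mid]
    calc (0 : ℝ) = -(C * k * √n) + k * -(3 * (√M * √n)) + k * ((C + 3 * √M) * √n) := by ring
      _ ≤ s + k * u + k * ∑ i ∈ Finset.Ioc (p + m) (p + m + n), X i ω := by
        gcongr
        linarith
      _ ≤ s + (k - 1) * u + k * ∑ i ∈ Finset.Ioc (p + m) (p + m + n), X i ω := by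
        linarith

end Walk

/-! ### The conditional probability of a crossing -/

lemma exists_div_le_signSumMass_mul_signSumMass {K M : ℝ} (hK : 0 < K) (hM : 0 < M) :
    ∃ c : ℝ, 0 < c ∧ ∀ᶠ k : ℕ in atTop, Odd k → ∀ m n : ℕ, k ^ 2 ≤ m → m ≤ M * n → ∀ s : ℤ,
      c / k ≤
        signSumMass m (residueWindow k (3 * √m) s) * signSumMass n (Set.Iic (-(K * √n))) := by
  obtain ⟨c₁, c₁_pos, window⟩ := exists_div_le_signSumMass_residueWindow
  obtain ⟨c₂, c₂_pos, tail⟩ := exists_le_signSumMass_Iic hK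
  obtain ⟨N₁, window⟩ := eventually_atTop.1 window
  obtain ⟨N₂, tail⟩ := eventually_atTop.1 tail
  refine ⟨c₁ * c₂, by positivity, ?_⟩
  filter_upwards [eventually_ge_atTop N₁, tendsto_natCast_atTop_atTop.eventually_ge_atTop (M * N₂)]
    with k hk₁ hk₂ k_odd m n hkm hmn s
  have k_le_m : k ≤ m := (Nat.le_self_pow two_ne_zero k).trans hkm
  have N₂_le_n : (N₂ : ℝ) ≤ n := by
    refine le_of_mul_le_mul_left ?_ hM
    calc M * N₂ ≤ k := hk₂
      _ ≤ m := by exact_mod_cast k_le_m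
      _ ≤ M * n := hmn
  have fst_le := window m (hk₁.trans k_le_m) k k_odd hkm s
  have snd_le := tail n (by exact_mod_cast N₂_le_n)
  calc c₁ * c₂ / k = c₁ / k * c₂ := by ring
    _ ≤ _ := mul_le_mul fst_le snd_le c₂_pos.le ((by positivity : 0 ≤ c₁ / k).trans fst_le)

lemma le_condExp_indicator_of_indep {Ω : Type*} {m m' mΩ : MeasurableSpace Ω}
    {μ : Measure Ω} [IsProbabilityMeasure μ] (hm : m ≤ mΩ) (hm' : m' ≤ mΩ)
    (hind : Indep m' m μ) {E F G : Set Ω} (hE : MeasurableSet E) (hF : MeasurableSet[m'] F)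
    (hG : MeasurableSet[m] G) (h : (G ∩ F : Set Ω) ≤ᵐ[μ] E) :
    ∀ᵐ ω ∂μ, ω ∈ G → μ.real F ≤ μ[E.indicator (1 : Ω → ℝ) | m] ω := by
  have integrable_one : ∀ {A : Set Ω}, MeasurableSet A → Integrable (A.indicator (1 : Ω → ℝ)) μ :=
    fun hA => (integrable_const (1 : ℝ)).indicator hA
  have integrable_inter := integrable_one ((hm _ hG).inter (hm' _ hF))
  have mono : μ[(G ∩ F).indicator (1 : Ω → ℝ) | m] ≤ᵐ[μ] μ[E.indicator (1 : Ω → ℝ) | m] := by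
    refine condExp_mono integrable_inter (integrable_one hE) ?_
    filter_upwards [h] with ω hω
    exact Set.indicator_apply_le' (fun hGF => by simp [show ω ∈ E from hω hGF])
      fun _ => Set.indicator_nonneg (fun _ _ => zero_le_one) ω
  rw [Set.inter_indicator_one] at integrable_inter mono
  have pull_out := condExp_mul_of_stronglyMeasurable_left
    ((@stronglyMeasurable_one _ _ m _ _).indicator hG) integrable_inter (integrable_one (hm' _ hF))
  have condExp_F := condExp_indep_eq hm' hm
    ((@stronglyMeasurable_one _ ℝ m' _ _).indicator hF) hind
  filter_upwards [mono, pull_out, condExp_F] with ω mono pull_out condExp_F hω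
  rwa [pull_out, Pi.mul_apply, condExp_F, Set.indicator_of_mem hω, Pi.one_apply, one_mul,
    integral_indicator_one (hm' _ hF)] at mono

namespace IsRademacherSeq

variable {Ω : Type*} [mΩ : MeasurableSpace Ω] {μ : Measure Ω} [IsProbabilityMeasure μ]
  {X : ℕ → Ω → ℝ}

lemma measureReal_crossingEvent (hX : IsRademacherSeq μ X) (p m n k : ℕ) (K : ℝ) (s : ℤ) :
    μ.real (crossingEvent X p m n k K s) =
      signSumMass m (residueWindow k (3 * √m) s) * signSumMass n (Set.Iic (-(K * √n))) := by
  have one_le : ∀ q r, ∀ i ∈ Finset.Ioc q r, 1 ≤ i := fun q r i hi =>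
    (Nat.zero_le q).trans_lt (Finset.mem_Ioc.1 hi).1
  have fst_eq := hX.measureReal_sum_mem (one_le p (p + m))
    (measurableSet_residueWindow k (3 * √m) s)
  have snd_eq := hX.neg.measureReal_sum_mem (one_le (p + m) (p + m + n))
    (measurableSet_Iic (a := -(K * √n)))
  simp only [Nat.card_Ioc, Nat.add_sub_cancel_left, Pi.neg_apply, Finset.sum_neg_distrib,
    Set.mem_Iic, neg_le_neg_iff] at fst_eq snd_eq
  have indep := (Indep_iff _ _ μ).1
    (hX.indep_stepSigma (Set.Ioc_disjoint_Ioc_of_le (le_refl (p + m)))) _ _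
    (measurableSet_crossingEvent_fst p m k s) (measurableSet_crossingEvent_snd (p + m) n K)
  rw [crossingEvent, measureReal_def, indep, ENNReal.toReal_mul, ← measureReal_def,
    ← measureReal_def, fst_eq, snd_eq]

lemma ae_measureReal_crossingEvent_le_condExp_zeroIn (hX : IsRademacherSeq μ X)
    {a : ℕ → ℕ} {p m n k : ℕ} (ha : IsBlockPair a p m n k) (hk : 1 ≤ k) {C M : ℝ} (hM : 0 ≤ M)
    (hmn : m ≤ M * n) {s : ℤ} (hs : s ≤ 0) (hsC : -(C * k * √n) ≤ s) :
    ∀ᵐ ω ∂μ, aWalk (fun i => (a i : ℝ)) X p ω = s →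
      μ.real (crossingEvent X p m n k (C + 3 * √M) s) ≤
        μ[(zeroIn a X (p + m) (p + m + n)).indicator (1 : Ω → ℝ) |
          stepSigma X (Set.Icc 1 p)] ω := by
  have disj : Disjoint (Set.Ioc p (p + m + n)) (Set.Icc 1 p) :=
    Set.disjoint_left.2 fun i hi hi' => hi.1.not_ge hi'.2
  refine le_condExp_indicator_of_indep (hX.stepSigma_le _) (hX.stepSigma_le _)
    (hX.indep_stepSigma disj) (hX.stepSigma_le _ _ (measurableSet_zeroIn a _ _))
    (measurableSet_crossingEvent p m n k _ s)
    (measurable_aWalk_stepSigma _ le_rfl (measurableSet_singleton (s : ℝ))) ?_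
  filter_upwards [hX.ae_forall_eq_or] with ω hω
  exact fun ⟨hstart, hcross⟩ =>
    ha.mem_zeroIn_of_mem_crossingEvent hk hM hmn hs hsC hω hcross hstart

lemma ae_le_condExp_zeroIn (hX : IsRademacherSeq μ X) {a : ℕ → ℕ} {p m n k : ℕ}
    (ha : IsBlockPair a p m n k) (hk : 1 ≤ k) {C M : ℝ} (hM : 0 ≤ M) (hmn : m ≤ M * n) {b : ℝ}
    (hb : ∀ s : ℤ, b ≤ signSumMass m (residueWindow k (3 * √m) s) *
      signSumMass n (Set.Iic (-((C + 3 * √M) * √n)))) :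
    ∀ᵐ ω ∂μ, |aWalk (fun i => (a i : ℝ)) X p ω| ≤ C * k * √n →
      b ≤ μ[(zeroIn a X (p + m) (p + m + n)).indicator (1 : Ω → ℝ) |
        stepSigma X (Set.Icc 1 p)] ω := by
  have of_nonpos : ∀ {Y : ℕ → Ω → ℝ}, IsRademacherSeq μ Y → ∀ᵐ ω ∂μ, ∀ s : ℤ, s ≤ 0 →
      -(C * k * √n) ≤ s → aWalk (fun i => (a i : ℝ)) Y p ω = s →
        b ≤ μ[(zeroIn a Y (p + m) (p + m + n)).indicator (1 : Ω → ℝ) |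
          stepSigma Y (Set.Icc 1 p)] ω := fun {Y} hY => by
    refine ae_all_iff.2 fun s => ae_all_iff.2 fun hs => ae_all_iff.2 fun hsC => ?_
    filter_upwards [hY.ae_measureReal_crossingEvent_le_condExp_zeroIn ha hk hM hmn hs hsC]
      with ω hω hstart
    rw [hY.measureReal_crossingEvent] at hω
    exact (hb s).trans (hω hstart)
  have of_nonneg := of_nonpos hX.neg
  simp only [zeroIn_neg, stepSigma_neg, aWalk_neg] at of_nonneg
  filter_upwards [of_nonpos hX, of_nonneg, hX.ae_forall_eq_or] with ω hnonpos hnonneg hω hstart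
  obtain ⟨s, hs⟩ := exists_int_eq_aWalk hω a p
  rw [hs, abs_le] at hstart
  rcases le_total s 0 with hs₀ | hs₀
  · exact hnonpos s hs₀ hstart.1 hs
  · exact hnonneg (-s) (by lia) (by push_cast; linarith) (by rw [hs]; push_cast; rfl)

end IsRademacherSeq

lemma exists_div_le_condExp_zeroIn_of_isBlockPair {C M : ℝ} (hC : 0 < C) (hM : 0 < M) :
    ∃ c : ℝ, 0 < c ∧ ∀ᶠ k : ℕ in atTop, Odd k → ∀ {a : ℕ → ℕ} {p m n : ℕ},
      IsBlockPair a p m n k → k ^ 2 ≤ m → m ≤ M * n →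
      ∀ {Ω : Type*} [MeasurableSpace Ω] {μ : Measure Ω} [IsProbabilityMeasure μ] {X : ℕ → Ω → ℝ},
        IsRademacherSeq μ X → ∀ᵐ ω ∂μ, |aWalk (fun i => (a i : ℝ)) X p ω| ≤ C * k * √n →
          c / k ≤ μ[(zeroIn a X (p + m) (p + m + n)).indicator (1 : Ω → ℝ) |
            stepSigma X (Set.Icc 1 p)] ω := by
  obtain ⟨c, c_pos, hc⟩ :=
    exists_div_le_signSumMass_mul_signSumMass (K := C + 3 * √M) (by positivity) hM
  refine ⟨c, c_pos, hc.mono fun k hk k_odd a p m n ha hkm hmn Ω _ μ _ X hX => ?_⟩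
  exact hX.ae_le_condExp_zeroIn ha k_odd.pos hM.le hmn (hk k_odd m n hkm hmn)

/-! ### A Borel–Cantelli lemma with exceptional events -/

section BorelCantelli

variable {Ω : Type*} [mΩ : MeasurableSpace Ω] {μ : Measure Ω} [IsProbabilityMeasure μ]
  {w : ℕ → ℝ} {A : ℕ → Set Ω} {δ : ℝ}

lemma sub_mul_measureReal_weighted_sum_le {s : Finset ℕ} (hw : ∀ j ∈ s, 0 ≤ w j)
    (hA : ∀ j ∈ s, MeasurableSet (A j)) (hδ : ∀ j ∈ s, μ.real (A j)ᶜ ≤ δ) (K : ℝ) :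
    (∑ j ∈ s, w j - K) * μ.real {ω | ∑ j ∈ s, w j * (A j).indicator 1 ω ≤ K} ≤
      (∑ j ∈ s, w j) * δ := by
  have integrable : ∀ j ∈ s, Integrable (fun ω => w j * (A j)ᶜ.indicator (1 : Ω → ℝ) ω) μ :=
    fun j hj => ((integrable_const (1 : ℝ)).indicator (hA j hj).compl).const_mul (w j)
  have nonneg : ∀ ω, 0 ≤ ∑ j ∈ s, w j * (A j)ᶜ.indicator (1 : Ω → ℝ) ω := fun ω =>
    Finset.sum_nonneg fun j hj =>
      mul_nonneg (hw j hj) (Set.indicator_nonneg (fun _ _ => zero_le_one) ω)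
  have markov := mul_meas_ge_le_integral_of_nonneg (ae_of_all μ nonneg)
    (integrable_finsetSum _ integrable) (∑ j ∈ s, w j - K)
  have sum_eq : ∀ ω, ∑ j ∈ s, w j * (A j)ᶜ.indicator (1 : Ω → ℝ) ω =
      ∑ j ∈ s, w j - ∑ j ∈ s, w j * (A j).indicator (1 : Ω → ℝ) ω := fun ω => by
    simp only [Set.indicator_compl, Pi.sub_apply, Pi.one_apply, mul_sub, mul_one,
      Finset.sum_sub_distrib]
  simp only [sum_eq, sub_le_sub_iff_left] at markov
  refine markov.trans ?_
  simp only [← sum_eq]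
  rw [integral_finsetSum _ integrable, Finset.sum_mul]
  refine Finset.sum_le_sum fun j hj => ?_
  rw [integral_const_mul, integral_indicator_one (hA j hj).compl]
  exact mul_le_mul_of_nonneg_left (hδ j hj) (hw j hj)

lemma measureReal_forall_weighted_sum_le (hw : ∀ j, 0 ≤ w j)
    (hdiv : Tendsto (fun n => ∑ j ∈ Finset.range n, w j) atTop atTop)
    (hA : ∀ j, MeasurableSet (A j)) (hδ : ∀ j, μ.real (A j)ᶜ ≤ δ) (K : ℝ) :
    μ.real {ω | ∀ n, ∑ j ∈ Finset.range n, w j * (A j).indicator 1 ω ≤ K} ≤ δ := by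
  set x := μ.real {ω | ∀ n, ∑ j ∈ Finset.range n, w j * (A j).indicator 1 ω ≤ K}
  by_contra! hlt
  obtain ⟨n, hn, hKn⟩ := (((hdiv.const_mul_atTop (sub_pos.2 hlt)).eventually_gt_atTop (K * x)).and
    (hdiv.eventually_ge_atTop K)).exists
  have := calc (∑ j ∈ Finset.range n, w j - K) * x
      ≤ (∑ j ∈ Finset.range n, w j - K) *
          μ.real {ω | ∑ j ∈ Finset.range n, w j * (A j).indicator 1 ω ≤ K} :=
        mul_le_mul_of_nonneg_left (measureReal_mono fun ω hω => hω n) (sub_nonneg.2 hKn)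
    _ ≤ (∑ j ∈ Finset.range n, w j) * δ :=
        sub_mul_measureReal_weighted_sum_le (fun j _ => hw j) (fun j _ => hA j) (fun j _ => hδ j) K
  linarith

lemma measure_not_tendsto_weighted_sum_le (hw : ∀ j, 0 ≤ w j)
    (hdiv : Tendsto (fun n => ∑ j ∈ Finset.range n, w j) atTop atTop)
    (hA : ∀ j, MeasurableSet (A j)) (hδ : ∀ j, μ.real (A j)ᶜ ≤ δ) :
    μ {ω | ¬ Tendsto (fun n => ∑ j ∈ Finset.range n, w j * (A j).indicator 1 ω) atTop atTop} ≤
      ENNReal.ofReal δ := by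
  let B : ℕ → Set Ω := fun K => {ω | ∀ n, ∑ j ∈ Finset.range n, w j * (A j).indicator 1 ω ≤ K}
  have B_mono : Monotone B := fun K K' hK ω hω n => (hω n).trans (by exact_mod_cast hK)
  calc _ ≤ μ (⋃ K, B K) := measure_mono fun ω hω => by
        have sum_mono : Monotone fun n =>
            ∑ j ∈ Finset.range n, w j * (A j).indicator (1 : Ω → ℝ) ω :=
          fun m n hmn => Finset.sum_le_sum_of_subset_of_nonneg (Finset.range_mono hmn) fun j _ _ =>
            mul_nonneg (hw j) (Set.indicator_nonneg (fun _ _ => zero_le_one) ω)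
        by_contra hB
        simp only [B, Set.mem_iUnion, Set.mem_ofPred_eq, not_exists, not_forall, not_le] at hB
        refine hω (tendsto_atTop_atTop_of_monotone sum_mono fun b => ?_)
        obtain ⟨n, hn⟩ := hB ⌈b⌉₊
        exact ⟨n, (Nat.le_ceil b).trans hn.le⟩
    _ = ⨆ K, μ (B K) := B_mono.measure_iUnion
    _ ≤ ENNReal.ofReal δ := iSup_le fun K => by
        rw [← ofReal_measureReal]
        exact ENNReal.ofReal_le_ofReal (measureReal_forall_weighted_sum_le hw hdiv hA hδ K)

lemma measure_compl_limsup_le_of_le_condExp {ℱ : Filtration ℕ mΩ} {E : ℕ → Set Ω}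
    (hE : ∀ j, MeasurableSet[ℱ j] (E j)) (hw : ∀ j, 0 ≤ w j)
    (hdiv : Tendsto (fun n => ∑ j ∈ Finset.range n, w j) atTop atTop)
    (hA : ∀ j, MeasurableSet (A j)) (hδ : ∀ j, μ.real (A j)ᶜ ≤ δ)
    (hwE : ∀ j, ∀ᵐ ω ∂μ, ω ∈ A j → w j ≤ μ[(E (j + 1)).indicator (1 : Ω → ℝ) | ℱ j] ω) :
    μ (limsup E atTop)ᶜ ≤ ENNReal.ofReal δ := by
  have condExp_nonneg : ∀ᵐ ω ∂μ, ∀ j, 0 ≤ μ[(E (j + 1)).indicator (1 : Ω → ℝ) | ℱ j] ω :=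
    ae_all_iff.2 fun j => condExp_nonneg
      (ae_of_all _ fun ω => Set.indicator_nonneg (fun _ _ => zero_le_one) ω)
  refine (measure_mono_ae ?_).trans (measure_not_tendsto_weighted_sum_le hw hdiv hA hδ)
  filter_upwards [ae_mem_limsup_atTop_iff (ℱ := ℱ) μ hE, condExp_nonneg, ae_all_iff.2 hwE]
    with ω levy nonneg le_condExp hω htends
  refine hω (levy.2 (tendsto_atTop_mono (fun n => Finset.sum_le_sum fun j _ => ?_) htends))
  by_cases hj : ω ∈ A j
  · simpa [hj] using le_condExp j hj
  · simpa [hj] using nonneg j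

end BorelCantelli

lemma tendsto_sum_range_div_linear_atTop {c : ℝ} (hc : 0 < c) (d b : ℕ) :
    Tendsto (fun n => ∑ j ∈ Finset.range n, c / (d * j + b + 1 : ℝ)) atTop atTop := by
  have harmonic := Real.tendsto_sum_range_one_div_nat_succ_atTop.const_mul_atTop
    (show 0 < c / (d + b + 1) by positivity)
  refine tendsto_atTop_mono (fun n => ?_) harmonic
  rw [Finset.mul_sum]
  refine Finset.sum_le_sum fun j _ => ?_
  rw [div_mul_div_comm, mul_one]
  gcongr
  nlinarith [(Nat.cast_nonneg j : (0 : ℝ) ≤ j), (Nat.cast_nonneg d : (0 : ℝ) ≤ d),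
    mul_nonneg (Nat.cast_nonneg (α := ℝ) b) (Nat.cast_nonneg (α := ℝ) j)]

/-! ### Recurrence of walks with slowly growing steps -/

lemma frequently_aWalk_eq_zero_of_mem_limsup {Ω : Type*} {X : ℕ → Ω → ℝ} {a p q : ℕ → ℕ}
    (hp : Tendsto p atTop atTop) {ω : Ω} (hω : ω ∈ limsup (fun j => zeroIn a X (p j) (q j)) atTop) :
    ∃ᶠ n in atTop, aWalk (fun i => (a i : ℝ)) X n ω = 0 := by
  rw [mem_limsup_iff_frequently_mem] at hω
  refine frequently_atTop.2 fun n => ?_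
  obtain ⟨j, ⟨i, hi, walk_eq⟩, hj⟩ := (hω.and_eventually (hp.eventually_ge_atTop n)).exists
  exact ⟨i, hj.trans hi.1, walk_eq⟩

/-- The terms `a 1, a 2, …` form a nondecreasing sequence in which exactly the first `N k` terms
are at most `k` and, for `k ≥ 1`, exactly `L k` terms equal `k`. -/
structure HasBlocks (a N L : ℕ → ℕ) : Prop where
  le_iff : ∀ i, 1 ≤ i → ∀ k, a i ≤ k ↔ i ≤ N k
  end_succ : ∀ k, N (k + 1) = N k + L (k + 1)

namespace HasBlocks

variable {a N L : ℕ → ℕ}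

lemma monotone (h : HasBlocks a N L) : Monotone N :=
  monotone_nat_of_le_succ fun k => h.end_succ k ▸ Nat.le_add_right _ _

lemma eq_succ_of_mem (h : HasBlocks a N L) {i k : ℕ} (hi : i ∈ Finset.Ioc (N k) (N (k + 1))) :
    a i = k + 1 := by
  obtain ⟨hi₁, hi₂⟩ := Finset.mem_Ioc.1 hi
  have le := (h.le_iff i (by lia) (k + 1)).2 hi₂
  have not_le := (h.le_iff i (by lia) k).not.2 (by lia)
  lia

lemma isBlockPair (h : HasBlocks a N L) (k : ℕ) :
    IsBlockPair a (N k) (L (k + 1)) (L (k + 2)) (k + 2) where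
  succ_eq_of_mem_fst i hi := by
    rw [h.eq_succ_of_mem (h.end_succ k ▸ hi)]
  eq_of_mem_snd i hi := h.eq_succ_of_mem (by rwa [h.end_succ (k + 1), h.end_succ k])

lemma sum_sq_le (h : HasBlocks a N L) (k : ℕ) :
    ∑ i ∈ Finset.Icc 1 (N k), (a i : ℝ) ^ 2 ≤ N k * k ^ 2 := by
  have term_le : ∀ i ∈ Finset.Icc 1 (N k), (a i : ℝ) ^ 2 ≤ k ^ 2 := fun i hi => by
    obtain ⟨hi₁, hik⟩ := Finset.mem_Icc.1 hi
    gcongr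
    exact (h.le_iff i hi₁ k).2 hik
  simpa using Finset.sum_le_card_nsmul _ _ _ term_le

lemma tendsto_end_atTop (h : HasBlocks a N L) (hL : ∀ᶠ k in atTop, (k + 1) ^ 2 ≤ L k) :
    Tendsto N atTop atTop := by
  refine (tendsto_add_atTop_iff_nat 1).1 (tendsto_atTop_mono' atTop ?_ tendsto_id)
  filter_upwards [(tendsto_add_atTop_nat 1).eventually hL] with k hk
  rw [id, h.end_succ]
  nlinarith

variable {Ω : Type*} [mΩ : MeasurableSpace Ω] {μ : Measure Ω} [IsProbabilityMeasure μ]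
  {X : ℕ → Ω → ℝ} {C M : ℝ}

lemma measureReal_compl_abs_aWalk_lt_le (h : HasBlocks a N L) (hX : IsRademacherSeq μ X)
    (hC : 0 < C) {k : ℕ} (hL : 0 < L (k + 2)) (hratio : N k ≤ M * L (k + 2)) :
    μ.real {ω | |aWalk (fun i => (a i : ℝ)) X (N k) ω| < C * (k + 2 : ℕ) * √(L (k + 2))}ᶜ ≤
      M / C ^ 2 := by
  have L_pos : (0 : ℝ) < L (k + 2) := by exact_mod_cast hL
  simp only [Set.compl_ofPred, not_lt]
  refine (hX.measureReal_le_abs_aWalk_le _ _ (by positivity)).trans ?_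
  rw [mul_pow, mul_pow, Real.sq_sqrt L_pos.le, div_le_div_iff₀ (by positivity) (by positivity)]
  calc (∑ i ∈ Finset.Icc 1 (N k), (a i : ℝ) ^ 2) * C ^ 2
      ≤ M * L (k + 2) * (k + 2 : ℕ) ^ 2 * C ^ 2 := by
        gcongr
        refine (h.sum_sq_le k).trans ?_
        gcongr
        · exact (Nat.cast_nonneg _).trans hratio
        · lia
    _ = M * (C ^ 2 * (k + 2 : ℕ) ^ 2 * L (k + 2)) := by ring

lemma exists_div_le_condExp_zeroIn (h : HasBlocks a N L) (hX : IsRademacherSeq μ X)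
    (hC : 0 < C) (hM : 0 < M) (hratio : ∀ᶠ k in atTop, N k ≤ M * L (k + 1))
    (hL : ∀ᶠ k in atTop, (k + 1) ^ 2 ≤ L k) :
    ∃ c : ℝ, 0 < c ∧ ∀ᶠ k : ℕ in atTop, Odd k → ∀ᵐ ω ∂μ,
      |aWalk (fun i => (a i : ℝ)) X (N k) ω| ≤ C * (k + 2 : ℕ) * √(L (k + 2)) →
        c / (k + 2 : ℕ) ≤ μ[(zeroIn a X (N (k + 1)) (N (k + 2))).indicator (1 : Ω → ℝ) |
          stepSigma X (Set.Icc 1 (N k))] ω := by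
  obtain ⟨c, c_pos, hc⟩ := exists_div_le_condExp_zeroIn_of_isBlockPair hC hM
  refine ⟨c, c_pos, ?_⟩
  filter_upwards [(tendsto_add_atTop_nat 2).eventually hc,
    (tendsto_add_atTop_nat 1).eventually hratio, (tendsto_add_atTop_nat 1).eventually hL]
    with k hck hratio hL k_odd
  have L_le_end : (L (k + 1) : ℝ) ≤ N (k + 1) := by
    exact_mod_cast h.end_succ k ▸ Nat.le_add_left _ _
  have crossing :=
    hck (k_odd.add_even even_two) (h.isBlockPair k) hL (L_le_end.trans hratio) hX
  rwa [← h.end_succ k, ← h.end_succ (k + 1)] at crossing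

lemma measure_not_frequently_aWalk_eq_zero_le (h : HasBlocks a N L) (hX : IsRademacherSeq μ X)
    (hC : 0 < C) (hM : 0 < M) (hratio : ∀ᶠ k in atTop, N k ≤ M * L (k + 1))
    (hL : ∀ᶠ k in atTop, (k + 1) ^ 2 ≤ L k) :
    μ {ω | ¬ ∃ᶠ n in atTop, aWalk (fun i => (a i : ℝ)) X n ω = 0} ≤
      ENNReal.ofReal (M / C ^ 2) := by
  obtain ⟨c, c_pos, crossing⟩ := h.exists_div_le_condExp_zeroIn hX hC hM hratio hL
  obtain ⟨J, hJ⟩ := eventually_atTop.1 (crossing.and (hratio.and hL))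
  let κ : ℕ → ℕ := fun j => 2 * (J + j) + 1
  let ℱ : Filtration ℕ mΩ :=
    { seq := fun j => stepSigma X (Set.Icc 1 (N (κ j)))
      mono' := fun i j hij => stepSigma_mono X (Set.Icc_subset_Icc_right (h.monotone (by lia)))
      le' := fun j => hX.stepSigma_le _ }
  let A : ℕ → Set Ω := fun j =>
    {ω | |aWalk (fun i => (a i : ℝ)) X (N (κ j)) ω| < C * (κ j + 2 : ℕ) * √(L (κ j + 2))}
  have bad_events := measure_compl_limsup_le_of_le_condExp (μ := μ) (ℱ := ℱ) (A := A)
    (E := fun j => zeroIn a X (N (2 * (J + j))) (N (κ j))) (w := fun j => c / (κ j + 2 : ℕ))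
    (δ := M / C ^ 2) (fun j => measurableSet_zeroIn a _ _) (fun j => by positivity) ?_ (fun j => ?_)
    (fun j => ?_) fun j => ?_
  · refine (measure_mono fun ω hω hlimsup => ?_).trans bad_events
    have starts_tendsto : Tendsto (fun j => N (2 * (J + j))) atTop atTop :=
      (h.tendsto_end_atTop hL).comp (tendsto_atTop_mono (fun j => show j ≤ _ by lia) tendsto_id)
    exact hω (frequently_aWalk_eq_zero_of_mem_limsup starts_tendsto hlimsup)
  · convert tendsto_sum_range_div_linear_atTop c_pos 2 (2 * J + 2) using 5 with n j
    push_cast [κ]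
    ring
  · exact measurableSet_lt
      ((measurable_aWalk_stepSigma _ le_rfl).mono (hX.stepSigma_le _) le_rfl).abs measurable_const
  · have end_le : (N (κ j) : ℝ) ≤ N (κ j + 1) := by exact_mod_cast h.monotone (Nat.le_succ _)
    exact h.measureReal_compl_abs_aWalk_lt_le hX hC
      ((by positivity : 0 < (κ j + 2 + 1) ^ 2).trans_le (hJ (κ j + 2) (by lia)).2.2)
      (end_le.trans (hJ (κ j + 1) (by lia)).2.1)
  · filter_upwards [(hJ (κ j) (by lia)).1 ⟨J + j, rfl⟩] with ω hω hωA
    exact hω (le_of_lt hωA)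

theorem aWalkRecurrent (h : HasBlocks a N L) (hX : IsRademacherSeq μ X) (hM : 0 < M)
    (hratio : ∀ᶠ k in atTop, N k ≤ M * L (k + 1)) (hL : ∀ᶠ k in atTop, (k + 1) ^ 2 ≤ L k) :
    AWalkRecurrent μ (fun i => (a i : ℝ)) X := by
  have bound_tendsto : Tendsto (fun C : ℝ => ENNReal.ofReal (M / C ^ 2)) atTop (nhds 0) := by
    rw [← ENNReal.ofReal_zero]
    exact (ENNReal.continuous_ofReal.tendsto 0).comp
      (tendsto_const_nhds.div_atTop (tendsto_pow_atTop two_ne_zero))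
  exact nonpos_iff_eq_zero.1 (ge_of_tendsto bound_tendsto ((eventually_gt_atTop 0).mono fun C hC =>
    h.measure_not_frequently_aWalk_eq_zero_le hX hC hM hratio hL))

end HasBlocks

/-! ### The growth condition -/

lemma HasBlocks.end_eq_add_sum {a N L : ℕ → ℕ} (h : HasBlocks a N L) (k : ℕ) :
    N k = N 0 + ∑ j ∈ Finset.Icc 1 k, L j := by
  induction k with
  | zero => simp
  | succ k ih => rw [Finset.sum_Icc_succ_top (by lia), ← add_assoc, ← ih, h.end_succ]

lemma sum_Icc_eq_sum_Icc_add_sum_Ioo {M : Type*} [AddCommMonoid M] (f : ℕ → M) {k' k : ℕ}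
    (h : k' ≤ k) :
    ∑ j ∈ Finset.Icc 1 k, f j =
      ∑ j ∈ Finset.Icc 1 k', f j + ∑ j ∈ Finset.Ioo k' (k + 1), f j := by
  have Ioo_eq : Finset.Ioo k' (k + 1) = Finset.Ioc k' k := by ext; simp
  rw [← zero_add 1, Finset.Icc_add_one_left_eq_Ioc, Finset.Icc_add_one_left_eq_Ioc, Ioo_eq,
    Finset.sum_Ioc_consecutive _ k'.zero_le h]

namespace BlockGrowth

variable {L : ℕ → ℕ}

-- The growth condition is applied with `k'` fixed, once `k / log k - 2 ≤ k - k'`.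
lemma exists_eventually_le (h : BlockGrowth L) :
    ∃ r : ℝ, 0 < r ∧ ∃ k' : ℕ, ∀ᶠ k in atTop, ∑ j ∈ Finset.Icc 1 k', (L j : ℝ) ≤ L k ∧
      r * ∑ j ∈ Finset.Ioo k' k, (L j : ℝ) ≤ L k ∧ k ^ 4 ≤ L k := by
  obtain ⟨ε, ε_pos, r, r_pos, k₀, growth⟩ := h
  refine ⟨2 * r, by positivity, k₀ + 1, ?_⟩
  filter_upwards [eventually_ge_atTop (2 * (k₀ + 1)),
    (Real.tendsto_log_atTop.comp tendsto_natCast_atTop_atTop).eventually_ge_atTop 2]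
    with k hk (two_le_log : 2 ≤ Real.log k)
  have hk_real : 2 * ((k₀ + 1 : ℕ) : ℝ) ≤ k := by exact_mod_cast hk
  have div_log_le : (k : ℝ) / Real.log k ≤ k / 2 := by gcongr
  obtain ⟨head_le, tail_le, pow_le⟩ :=
    growth k (k₀ + 1) (by lia) (by lia) (by lia) (by lia) (by linarith)
  refine ⟨le_trans ?_ head_le, tail_le, by exact_mod_cast pow_le⟩
  exact le_mul_of_one_le_left (Finset.sum_nonneg fun _ _ => Nat.cast_nonneg _) (by nlinarith)

lemma eventually_succ_sq_le (h : BlockGrowth L) : ∀ᶠ k in atTop, (k + 1) ^ 2 ≤ L k := by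
  obtain ⟨r, -, k', growth⟩ := h.exists_eventually_le
  filter_upwards [growth, eventually_ge_atTop 2] with k hk two_le
  calc (k + 1) ^ 2 ≤ (k ^ 2) ^ 2 := by
        gcongr
        nlinarith
    _ = k ^ 4 := by ring
    _ ≤ L k := hk.2.2

lemma exists_sum_le_mul (h : BlockGrowth L) :
    ∃ M : ℝ, 0 < M ∧ ∀ᶠ k in atTop, ∑ j ∈ Finset.Icc 1 k, (L j : ℝ) ≤ M * L (k + 1) := by
  obtain ⟨r, r_pos, k', growth⟩ := h.exists_eventually_le
  refine ⟨1 + r⁻¹, by positivity, ?_⟩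
  filter_upwards [(tendsto_add_atTop_nat 1).eventually growth, eventually_ge_atTop k']
    with k ⟨head_le, tail_le, _⟩ hk
  rw [sum_Icc_eq_sum_Icc_add_sum_Ioo _ hk, add_mul, one_mul]
  exact add_le_add head_le ((le_inv_mul_iff₀ r_pos).2 tail_le)

end BlockGrowth

theorem HasBlocks.aWalkRecurrent_of_blockGrowth {a N L : ℕ → ℕ} (h : HasBlocks a N L)
    (hL : BlockGrowth L) {Ω : Type*} [MeasurableSpace Ω] {μ : Measure Ω} [IsProbabilityMeasure μ]
    {X : ℕ → Ω → ℝ} (hX : IsRademacherSeq μ X) : AWalkRecurrent μ (fun i => (a i : ℝ)) X := by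
  obtain ⟨M, M_pos, sum_le⟩ := hL.exists_sum_le_mul
  refine h.aWalkRecurrent hX (M := N 0 + M) (by positivity) ?_ hL.eventually_succ_sq_le
  filter_upwards [sum_le, (tendsto_add_atTop_nat 1).eventually hL.eventually_succ_sq_le]
    with k sum_le sq_le
  have one_le : (1 : ℝ) ≤ L (k + 1) := by exact_mod_cast (Nat.one_le_pow _ _ (by lia)).trans sq_le
  rw [h.end_eq_add_sum k, add_mul]
  push_cast
  exact add_le_add (le_mul_of_one_le_right (Nat.cast_nonneg _) one_le) sum_le

lemma tendsto_div_log_atTop : Tendsto (fun x : ℝ => x / Real.log x) atTop atTop := by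
  have log_div_tendsto :
      Tendsto (fun x : ℝ => Real.log x / x) atTop (nhdsWithin 0 (Set.Ioi 0)) := by
    refine tendsto_nhdsWithin_iff.2 ⟨Real.isLittleO_log_id_atTop.tendsto_div_nhds_zero, ?_⟩
    filter_upwards [eventually_gt_atTop 1] with x hx
    exact div_pos (Real.log_pos hx) (by linarith)
  exact log_div_tendsto.inv_tendsto_nhdsGT_zero.congr fun x => inv_div _ _

lemma eventually_log_le_div_log : ∀ᶠ x : ℝ in atTop, Real.log x ≤ x / Real.log x := by
  filter_upwards [(Real.isLittleO_pow_log_id_atTop (n := 2)).bound one_pos, eventually_gt_atTop 1]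
    with x hx x_gt
  rw [le_div_iff₀ (Real.log_pos x_gt), ← sq]
  rwa [one_mul, Real.norm_of_nonneg (by positivity), id, Real.norm_of_nonneg (by linarith)] at hx

lemma eventually_le_mul_rpow_sub {γ θ : ℝ} (hγ : 1 < γ) (hθ : 0 < θ) (b : ℝ) :
    ∀ᶠ y : ℝ in atTop, y ≤ θ * γ ^ (y - b) := by
  have γ_pos : 0 < γ := by linarith
  have bound := (isLittleO_rpow_exp_pos_mul_atTop 1 (Real.log_pos hγ)).bound
    (show 0 < θ * γ ^ (-b) by positivity)
  filter_upwards [bound, eventually_ge_atTop 0] with y hy y_nonneg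
  rw [Real.rpow_one, Real.norm_of_nonneg y_nonneg, Real.norm_of_nonneg (by positivity),
    ← Real.rpow_def_of_pos γ_pos, mul_assoc, ← Real.rpow_add γ_pos, neg_add_eq_sub] at hy
  exact hy

lemma pow_mul_le_of_mul_le_succ {γ : ℝ} (hγ : 0 ≤ γ) {G : ℕ → ℝ} (hG : ∀ k, γ * G k ≤ G (k + 1))
    (k d : ℕ) : γ ^ d * G k ≤ G (k + d) := by
  induction d with
  | zero => simp
  | succ d ih =>
    calc γ ^ (d + 1) * G k = γ * (γ ^ d * G k) := by ring
      _ ≤ γ * G (k + d) := by gcongr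
      _ ≤ G (k + (d + 1)) := hG _

section Geometric

variable {γ θ : ℝ} {G : ℕ → ℝ}

lemma eventually_pow_le_mul_of_geometric (hγ : 1 < γ) (hθ : 0 < θ) (hG₀ : 0 < G 0)
    (hG : ∀ k, γ * G k ≤ G (k + 1)) (d : ℕ) : ∀ᶠ k : ℕ in atTop, (k : ℝ) ^ d ≤ θ * G k := by
  filter_upwards [(tendsto_pow_const_div_const_pow_of_one_lt d hγ).eventually_le_const
    (mul_pos hθ hG₀)] with k hk
  rw [div_le_iff₀ (by positivity)] at hk
  calc (k : ℝ) ^ d ≤ θ * (γ ^ k * G 0) := by linarith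
    _ ≤ θ * G k := by
      gcongr
      simpa using pow_mul_le_of_mul_le_succ (by linarith) hG 0 k

lemma eventually_log_mul_le_of_geometric (hγ : 1 < γ) (hθ : 0 < θ) (hG₀ : ∀ k, 0 ≤ G k)
    (hG : ∀ k, γ * G k ≤ G (k + 1)) :
    ∀ᶠ k : ℕ in atTop, ∀ k' : ℕ, (k : ℝ) - k' ≥ k / Real.log k - 2 →
      Real.log k * G k' ≤ θ * G k := by
  have div_log_tendsto := tendsto_div_log_atTop.comp (tendsto_natCast_atTop_atTop (R := ℝ))
  filter_upwards [tendsto_natCast_atTop_atTop.eventually eventually_log_le_div_log,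
    div_log_tendsto.eventually (eventually_le_mul_rpow_sub hγ hθ 2),
    div_log_tendsto.eventually_ge_atTop 2] with k log_le
    (le_rpow : (k : ℝ) / Real.log k ≤ θ * γ ^ ((k : ℝ) / Real.log k - 2))
    (two_le : 2 ≤ (k : ℝ) / Real.log k) k' hk'
  have le : k' ≤ k := by exact_mod_cast (by linarith : (k' : ℝ) ≤ k)
  have rpow_le : γ ^ ((k : ℝ) / Real.log k - 2) ≤ γ ^ (k - k') := by
    rw [← Real.rpow_natCast γ (k - k'), Nat.cast_sub le]
    exact Real.rpow_le_rpow_of_exponent_le hγ.le hk'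
  calc Real.log k * G k' ≤ θ * γ ^ (k - k') * G k' := by
        refine mul_le_mul_of_nonneg_right ?_ (hG₀ k')
        exact (log_le.trans le_rpow).trans (by gcongr)
    _ = θ * (γ ^ (k - k') * G k') := by ring
    _ ≤ θ * G (k' + (k - k')) := by
        gcongr
        exact pow_mul_le_of_mul_le_succ (by linarith) hG k' _
    _ = θ * G k := by rw [Nat.add_sub_cancel' le]

lemma blockGrowth_of_geometric (hγ : 1 < γ) (hθ : 0 < θ) (hG₀ : 0 < G 0)
    (hG : ∀ k, γ * G k ≤ G (k + 1)) {L : ℕ → ℕ} (hLG : ∀ᶠ k in atTop, θ * G k ≤ L k)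
    (hsum : ∀ k, ∑ j ∈ Finset.Icc 1 k, (L j : ℝ) ≤ G k) : BlockGrowth L := by
  have G_nonneg : ∀ k, 0 ≤ G k := fun k =>
    (Finset.sum_nonneg fun _ _ => Nat.cast_nonneg _).trans (hsum k)
  obtain ⟨k₀, hk₀⟩ := eventually_atTop.1 (hLG.and
    ((eventually_pow_le_mul_of_geometric hγ hθ hG₀ hG 4).and
      (eventually_log_mul_le_of_geometric hγ (by positivity : 0 < θ / 3) G_nonneg hG)))
  refine ⟨1, one_pos, θ / 2, by positivity, k₀, fun k k' _ hk' hk₀k _ hkk' => ?_⟩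
  obtain ⟨le_L, pow_le, log_mul_le⟩ := hk₀ k hk₀k
  refine ⟨?_, ?_, pow_le.trans le_L⟩
  · calc (2 + 1) * Real.log k * ∑ j ∈ Finset.Icc 1 k', (L j : ℝ)
        ≤ (2 + 1) * Real.log k * G k' := by
          have := Real.log_natCast_nonneg k
          gcongr
          exact hsum k'
      _ ≤ θ * G k := by linarith [log_mul_le k' hkk']
      _ ≤ L k := le_L
  · have Ioo_subset : Finset.Ioo k' k ⊆ Finset.Icc 1 k := fun j hj => by
      simp only [Finset.mem_Ioo, Finset.mem_Icc] at hj ⊢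
      lia
    calc 2 * (θ / 2) * ∑ j ∈ Finset.Ioo k' k, (L j : ℝ)
        = θ * ∑ j ∈ Finset.Ioo k' k, (L j : ℝ) := by ring
      _ ≤ θ * G k := by
        gcongr
        exact (Finset.sum_le_sum_of_subset_of_nonneg Ioo_subset
          fun _ _ _ => Nat.cast_nonneg _).trans (hsum k)
      _ ≤ L k := le_L

lemma HasBlocks.blockGrowth_of_end_geometric {a N L : ℕ → ℕ} (h : HasBlocks a N L) (hγ : 1 < γ)
    (hG₀ : 0 < G 0) (hG : ∀ k, γ * G k ≤ G (k + 1)) (hlower : ∀ k, G k - 1 ≤ N k)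
    (hupper : ∀ k, N k ≤ G k) : BlockGrowth L := by
  have γ_pos : 0 < γ := by linarith
  have θ_pos : 0 < (1 - γ⁻¹) / 2 := by
    linarith [inv_lt_one_of_one_lt₀ hγ]
  refine blockGrowth_of_geometric hγ θ_pos hG₀ hG ?_ fun k => ?_
  · refine (eventually_ge_atTop 1).and (eventually_pow_le_mul_of_geometric hγ θ_pos hG₀ hG 0)
      |>.mono ?_
    rintro (_ | k) ⟨hk, one_le⟩
    · lia
    have G_le : G k ≤ γ⁻¹ * G (k + 1) := (le_inv_mul_iff₀ γ_pos).2 (hG k)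
    have L_eq : (L (k + 1) : ℝ) = N (k + 1) - N k := by
      rw [h.end_succ k]
      push_cast
      ring
    rw [pow_zero] at one_le
    linarith [hlower (k + 1), hupper k]
  · refine le_trans ?_ (hupper k)
    rw [h.end_eq_add_sum k]
    push_cast
    linarith [Nat.cast_nonneg (α := ℝ) (N 0)]

end Geometric

/-! ### The three step sequences -/

lemma hasBlocks_blockLength {a N : ℕ → ℕ} (ha : ∀ i, 1 ≤ i → ∀ k, a i ≤ k ↔ i ≤ N k) :
    HasBlocks a N (blockLength a) where
  le_iff := ha
  end_succ k := by
    have end_le : N k ≤ N (k + 1) := by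
      rcases Nat.eq_zero_or_pos (N k) with eq_zero | pos
      · simp [eq_zero]
      · exact (ha _ pos _).1 (((ha _ pos k).2 le_rfl).trans k.le_succ)
    have level_set_eq : {i : ℕ | 1 ≤ i ∧ a i = k + 1} = Finset.Ioc (N k) (N (k + 1)) := by
      ext i
      simp only [Set.mem_ofPred_eq, Finset.coe_Ioc, Set.mem_Ioc]
      constructor
      · rintro ⟨one_le, a_eq⟩
        have := ha i one_le k
        have := ha i one_le (k + 1)
        lia
      · rintro ⟨lt, le⟩
        have := ha i (by lia) k
        have := ha i (by lia) (k + 1)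
        lia
    rw [blockLength, level_set_eq, Set.ncard_coe_finset, Nat.card_Ioc]
    lia

lemma hasBlocks_blockSeq {L : ℕ → ℕ} (hL : ∀ i, ∃ k, i ≤ ∑ j ∈ Finset.Icc 1 k, L j) :
    HasBlocks (blockSeq L) (fun k => ∑ j ∈ Finset.Icc 1 k, L j) L where
  le_iff i _ k := by
    refine ⟨fun le => ?_, fun le => Nat.sInf_le le⟩
    have le_sum_blockSeq : i ≤ ∑ j ∈ Finset.Icc 1 (blockSeq L i), L j := Nat.sInf_mem (hL i)
    exact le_sum_blockSeq.trans (Finset.sum_le_sum_of_subset (Finset.Icc_subset_Icc_right le))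
  end_succ k := Finset.sum_Icc_succ_top (by lia) L

lemma le_sum_Icc_of_one_le {L : ℕ → ℕ} (hL : ∀ k, 1 ≤ k → 1 ≤ L k) (n : ℕ) :
    n ≤ ∑ j ∈ Finset.Icc 1 n, L j := by
  simpa using Finset.card_nsmul_le_sum (Finset.Icc 1 n) L 1
    fun j hj => hL j (Finset.mem_Icc.1 hj).1

lemma hasBlocks_floorLogSeq {γ β : ℝ} (hγ : 1 < γ) (hβ : 0 < β) :
    HasBlocks (floorLogSeq γ β) (fun k => ⌈γ ^ (((k : ℝ) + 1) ^ β⁻¹)⌉₊ - 1)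
      (blockLength (floorLogSeq γ β)) := by
  refine hasBlocks_blockLength fun i hi k => ?_
  have one_le : (1 : ℝ) ≤ i := by exact_mod_cast hi
  have logb_nonneg : 0 ≤ Real.logb γ i := Real.logb_nonneg hγ one_le
  rw [floorLogSeq, ← Nat.lt_succ_iff, Nat.floor_lt (by positivity),
    Nat.le_sub_one_iff_lt (Nat.ceil_pos.2 (by positivity)), Nat.lt_ceil,
    ← Real.logb_lt_iff_lt_rpow hγ (by linarith),
    Real.lt_rpow_inv_iff_of_pos logb_nonneg (by positivity) hβ, Nat.cast_succ]

lemma hasBlocks_ceilLogSeq {γ : ℝ} (hγ : 1 < γ) :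
    HasBlocks (ceilLogSeq γ) (fun k => ⌊γ ^ k⌋₊) (blockLength (ceilLogSeq γ)) := by
  refine hasBlocks_blockLength fun i hi k => ?_
  rw [ceilLogSeq, Nat.ceil_le, Real.logb_le_iff_le_rpow hγ (by exact_mod_cast hi),
    Real.rpow_natCast, Nat.le_floor_iff (by positivity)]

lemma mul_rpow_rpow_le_rpow_succ_rpow {γ p x : ℝ} (hγ : 1 ≤ γ) (hp : 1 ≤ p) (hx : 0 ≤ x) :
    γ * γ ^ (x ^ p) ≤ γ ^ ((x + 1) ^ p) := by
  have exponent_le : x ^ p + 1 ≤ (x + 1) ^ p := by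
    simpa using Real.add_rpow_le_rpow_add hx zero_le_one hp
  calc γ * γ ^ (x ^ p) = γ ^ (x ^ p + 1) := by
        rw [Real.rpow_add (by linarith), Real.rpow_one, mul_comm]
    _ ≤ γ ^ ((x + 1) ^ p) := Real.rpow_le_rpow_of_exponent_le hγ exponent_le

lemma blockGrowth_floorLogSeq {γ β : ℝ} (hγ : 1 < γ) (hβ : 0 < β) (hβ' : β ≤ 1) :
    BlockGrowth (blockLength (floorLogSeq γ β)) := by
  have end_cast (k : ℕ) : ((⌈γ ^ (((k : ℝ) + 1) ^ β⁻¹)⌉₊ - 1 : ℕ) : ℝ) =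
      ⌈γ ^ (((k : ℝ) + 1) ^ β⁻¹)⌉₊ - 1 :=
    Nat.cast_pred (Nat.ceil_pos.2 (by positivity))
  refine (hasBlocks_floorLogSeq hγ hβ).blockGrowth_of_end_geometric
    (G := fun k => γ ^ (((k : ℝ) + 1) ^ β⁻¹)) hγ (by positivity) (fun k => ?_) (fun k => ?_)
    fun k => ?_
  · rw [Nat.cast_succ]
    exact mul_rpow_rpow_le_rpow_succ_rpow hγ.le ((one_le_inv₀ hβ).2 hβ') (by positivity)
  · rw [end_cast]
    gcongr
    exact Nat.le_ceil _
  · rw [end_cast, sub_le_iff_le_add]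
    exact (Nat.ceil_lt_add_one (by positivity)).le

lemma blockGrowth_ceilLogSeq {γ : ℝ} (hγ : 1 < γ) : BlockGrowth (blockLength (ceilLogSeq γ)) :=
  (hasBlocks_ceilLogSeq hγ).blockGrowth_of_end_geometric (G := fun k => γ ^ k) hγ (by simp)
    (fun k => (pow_succ' γ k).ge) (fun _ => (Nat.sub_one_lt_floor _).le)
    fun _ => Nat.floor_le (by positivity)

theorem mainTheorem6 {Ω : Type*} [MeasurableSpace Ω] (μ : Measure Ω) [IsProbabilityMeasure μ]
    (X : ℕ → Ω → ℝ) (hX : IsRademacherSeq μ X) :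
    (∀ L : ℕ → ℕ, (∀ k, 1 ≤ k → 1 ≤ L k) → BlockGrowth L →
      AWalkRecurrent μ (fun i => (blockSeq L i : ℝ)) X) ∧
    (∀ γ β : ℝ, 1 < γ → 0 < β → β ≤ 1 →
      BlockGrowth (blockLength (floorLogSeq γ β)) ∧
      AWalkRecurrent μ (fun i => (floorLogSeq γ β i : ℝ)) X) ∧
    (∀ γ : ℝ, 1 < γ →
      BlockGrowth (blockLength (ceilLogSeq γ)) ∧
      AWalkRecurrent μ (fun i => (ceilLogSeq γ i : ℝ)) X) := by
  refine ⟨fun L one_le growth => ?_, fun γ β hγ hβ hβ' => ?_, fun γ hγ => ?_⟩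
  · have le_sum (i : ℕ) : ∃ k, i ≤ ∑ j ∈ Finset.Icc 1 k, L j := ⟨i, le_sum_Icc_of_one_le one_le i⟩
    exact (hasBlocks_blockSeq le_sum).aWalkRecurrent_of_blockGrowth growth hX
  · have growth := blockGrowth_floorLogSeq hγ hβ hβ'
    exact ⟨growth, (hasBlocks_floorLogSeq hγ hβ).aWalkRecurrent_of_blockGrowth growth hX⟩
  · have growth := blockGrowth_ceilLogSeq hγ
    exact ⟨growth, (hasBlocks_ceilLogSeq hγ).aWalkRecurrent_of_blockGrowth growth hX⟩
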